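/- **Corollary (information complexity of Greater-Than).** *Protocols.* A private-coin protocol is a finite binary tree. Each inner node is owned by Alice or by Bob, and its owner sends one bit whose distribution depends on the node and on the owner's input; each leaf carries an output. A public-coin protocol $\pi$ is a (discrete) distribution on private-coin protocols. Its transcript $\Pi$ consists of the outcome of the public randomness and all bits sent, and its communication cost is the maximum number of bits sent in any run. *Information.* Let $\mu$ be a distribution on $\mathcal X\times\mathcal Y$ and let $(X,Y)\sim\mu$ be the inputs. The internal information cost of $\pi$ is $\mathrm{IC}_\mu(\pi)=I(\Pi;X\mid Y)+I(\Pi;Y\mid X)$ (in bits). For $f:\mathcal X\times\mathcal Y\to\{0,1\}$, the information complexity of $f$ under $\mu$ with error $\rho$ is $$\mathrm{IC}_\mu(f,\rho)=\inf\{\mathrm{IC}_\mu(\pi):\ \pi \text{ a public-coin protocol with } \Pr[\pi(X,Y)\neq f(X,Y)]\le\rho\},$$ where the probability is over $(X,Y)\sim\mu$ and all coins. *Greater-Than.* For $n\ge1$ and $x,y\in\{0,1\}^n$, read as binary numbers with the most significant bit first, let $GT_n(x,y)=1$ if $x>y$ and $GT_n(x,y)=0$ otherwise. Let $\mu_n$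 be the distribution of the pair $(x,y)$ obtained as follows: choose $k\in\{1,\dots,n\}$ uniformly, choose independent uniform bits $z_1,\dots,z_{k-1},w,x_{k+1},\dots,x_n,y_{k+1},\dots,y_n$, and put $$x=z_1\cdots z_{k-1}\,w\,x_{k+1}\cdots x_n,\qquad y=z_1\cdots z_{k-1}\,\overline{w}\,y_{k+1}\cdots y_n .$$ *Statement.* 1. (Lower bound) $\mathrm{IC}_{\mu_n}(GT_n,1/10)=\Omega(\log n)$: there are $c>0$ and $n_0$ such that $\mathrm{IC}_{\mu_n}(GT_n,1/10)\ge c\log_2 n$ for all $n\ge n_0$. 2. (Tightness) There is a constant $C>0$ such that for every $n\ge2$ there is a public-coin protocol with communication cost at most $C\log_2 n$ that on every input pair $(x,y)$ outputs $GT_n(x,y)$ with probability at least $9/10$; moreover $\mathrm{IC}_{\mu_n}(GT_n,1/10)\le C\log_2 n$. Hence $\mathrm{IC}_{\mu_n}(GT_n,1/10)=\Theta(\log n)$. -/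

import Mathlib

noncomputable section

/-! ### Entropy and mutual information of discrete distributions (in bits) -/

/-- `H(A | B) = E_b [H(A | B = b)]` for the first and second coordinate of `q`, where
`H(A | B = b) = ∑ a, Pr[a | b] log₂ (1 / Pr[a | b])`.  The values `b` of probability `0`
have weight `0`. -/
def condEntropy {A B : Type*} [Fintype A] (q : PMF (A × B)) : ℝ :=
  ∑' b : B, (q.map Prod.snd b).toReal *
    ∑ a : A, ((q (a, b)).toReal / (q.map Prod.snd b).toReal) *
      Real.logb 2 (1 / ((q (a, b)).toReal / (q.map Prod.snd b).toReal))

/-- `I(A ; B | C) = H(A | C) - H(A | B C)` for the three coordinates of `q`. -/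
def condMutualInfo {A B C : Type*} [Fintype A] (q : PMF (A × B × C)) : ℝ :=
  condEntropy (q.map fun s => (s.1, s.2.2)) - condEntropy q

/-! ### Communication protocols -/

/-- Private-coin protocols, as finite binary trees: the owner of an inner node sends one bit, drawn
from a distribution that depends on the node and on the owner's input (`false` and `true` lead to
`child false` and `child true`); leaves carry outputs. -/
inductive PrivateProtocol (X Y Z : Type*)
  | leaf (z : Z)
  | alice (send : X → PMF Bool) (child : Bool → PrivateProtocol X Y Z)
  | bob (send : Y → PMF Bool) (child : Bool → PrivateProtocol X Y Z)

/-- The joint distribution of the sequence of bits sent and of the output, on inputs `x`, `y`. -/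
def PrivateProtocol.run {X Y Z : Type*} :
    PrivateProtocol X Y Z → X → Y → PMF (List Bool × Z)
  | .leaf z, _, _ => PMF.pure ([], z)
  | .alice send child, x, y =>
      (send x).bind fun b => ((child b).run x y).map fun s => (b :: s.1, s.2)
  | .bob send child, x, y =>
      (send y).bind fun b => ((child b).run x y).map fun s => (b :: s.1, s.2)

/-- A public-coin protocol is a distribution on private-coin protocols. -/
abbrev PublicProtocol (X Y Z : Type*) := PMF (PrivateProtocol X Y Z)

/-- A transcript: the outcome of the public randomness (the private-coin protocol it selects)
together with all bits sent. -/
abbrev Transcript (X Y Z : Type*) := PrivateProtocol X Y Z × List Bool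

namespace PublicProtocol

/-- The joint distribution of the transcript and of the output, on inputs `x`, `y`. -/
def run {X Y Z : Type*} (π : PublicProtocol X Y Z) (x : X) (y : Y) :
    PMF (Transcript X Y Z × Z) :=
  π.bind fun r => (r.run x y).map fun s => ((r, s.1), s.2)

/-- The communication cost: the maximal number of bits sent in any run. -/
def commCost {X Y Z : Type*} (π : PublicProtocol X Y Z) : ℕ∞ :=
  ⨆ (x : X) (y : Y) (s ∈ (run π x y).support), (s.1.2.length : ℕ∞)

/-- The probability, over all coins, that the output on inputs `x`, `y` differs from `f x y`. -/
def errorAt {X Y Z : Type*} (π : PublicProtocol X Y Z) (f : X → Y → Z) (x : X) (y : Y) : ℝ :=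
  ((run π x y).toOuterMeasure {s | s.2 ≠ f x y}).toReal

/-- The joint distribution of inputs drawn from `μ`, transcript and output. -/
def joint {X Y Z : Type*} (π : PublicProtocol X Y Z) (μ : PMF (X × Y)) :
    PMF ((X × Y) × Transcript X Y Z × Z) :=
  μ.bind fun p => (run π p.1 p.2).map fun s => (p, s)

/-- The probability, over inputs drawn from `μ` and all coins, that the output differs from `f`. -/
def errorProb {X Y Z : Type*} (π : PublicProtocol X Y Z) (f : X → Y → Z) (μ : PMF (X × Y)) : ℝ :=
  ((joint π μ).toOuterMeasure {s | s.2.2 ≠ f s.1.1 s.1.2}).toReal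

/-- The (internal) information cost `I(Π ; X | Y) + I(Π ; Y | X)`. Mutual information being
symmetric, it is written `I(X ; Π | Y) + I(Y ; Π | X)`, so that only entropies of the finitely
valued inputs occur. -/
def infoCost {X Y Z : Type*} [Fintype X] [Fintype Y]
    (π : PublicProtocol X Y Z) (μ : PMF (X × Y)) : ℝ :=
  condMutualInfo ((joint π μ).map fun s => (s.1.1, s.2.1, s.1.2)) +
    condMutualInfo ((joint π μ).map fun s => (s.1.2, s.2.1, s.1.1))

end PublicProtocol

/-- The information complexity of `f` under `μ` with error `ρ`: the infimum of the information
costs of all protocols whose error under `μ` is at most `ρ`. -/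
def informationComplexity {X Y Z : Type*} [Fintype X] [Fintype Y]
    (f : X → Y → Z) (μ : PMF (X × Y)) (ρ : ℝ) : ℝ :=
  sInf {c : ℝ | ∃ π : PublicProtocol X Y Z, π.errorProb f μ ≤ ρ ∧ π.infoCost μ = c}

/-! ### The Greater-Than function -/

/-- The number with the binary expansion `x`, most significant bit first. -/
def bitsValue {n : ℕ} (x : Fin n → Bool) : ℕ :=
  ∑ i : Fin n, (x i).toNat * 2 ^ (Fin.rev i : ℕ)

/-- `GT_n (x, y) = 1` iff `x > y`. -/
def greaterThan (n : ℕ) (x y : Fin n → Bool) : Bool :=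
  decide (bitsValue y < bitsValue x)

/-- The distribution `μ_n`: draw a uniformly random position `k`; `x` and `y` agree before `k`,
differ at `k`, and are independent after `k`, all bits being uniformly random.
(Only the entries of `z` before `k` and of `u`, `v` after `k` are used.) -/
def gtDist (n : ℕ) [NeZero n] : PMF ((Fin n → Bool) × (Fin n → Bool)) :=
  (PMF.uniformOfFintype (Fin n)).bind fun k =>
  (PMF.uniformOfFintype (Fin n → Bool)).bind fun z =>
  (PMF.uniformOfFintype Bool).bind fun w =>
  (PMF.uniformOfFintype (Fin n → Bool)).bind fun u =>
  (PMF.uniformOfFintype (Fin n → Bool)).bind fun v =>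
  PMF.pure
    (fun i => if i < k then z i else if i = k then w else u i,
     fun i => if i < k then z i else if i = k then !w else v i)

end

/-! Lower bound. Given the inputs, a transcript has probability (public coins) × (Alice's weight) ×
(Bob's weight). Information cost is the mean of two log-likelihood ratios, so cost far below `logb 2
M` means that, with high probability, neither ratio exceeds `M`: each player's weight is then at
most `M` times its conditional mean given the other's input. Cutting the weights at these guesses
loses little mass (`logb_mul_tail_le_condMutualInfo`, `aliceJoint_sub_cutJoint_le`). For a fixed
transcript the cut law is `μ` times two kernels of the form min(s(x), t(y)). Such a kernel is an
integral of rectangles, so it preserves a bilinear discrepancy bound `δ` up to its diagonal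
(`BilinearBound.mul_min`), and the diagonal is `M` times the probability of the transcript
(`sum_cutJoint_le`). The correlation of output and function is thus at most 2Mδ plus the tails,
while error 1/10 makes it at least 8/10 (`logb_mul_le_infoCost`).

For Greater-Than, δ = 1/√n (`bilinearBound_gtDist`): position k pairs a martingale difference of one
test function with a prefix average of the other. The squares of the differences sum over k to at
most one squared norm, those of the averages to at most n, and Cauchy–Schwarz gains √n. Then M =
n^(1/4) gives Ω(log n).

Upper bound. A binary search with backtracking locates the first differing bit, comparing prefixes
by random hashes of constant length (`failure_searchProtocol_le`). It takes O(log n) rounds of 16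
bits, and communication bounds information (`infoCost_le_of_commCost_le`). -/

namespace PMF

/-! ### Real-valued sums against discrete distributions -/

theorem hasSum_toReal {α : Type*} (p : PMF α) : HasSum (fun a => (p a).toReal) 1 := by
  have h := (ENNReal.hasSum_toReal (f := p) p.tsum_coe_ne_top)
  rwa [← ENNReal.tsum_toReal_eq (fun a => p.apply_ne_top a), p.tsum_coe, ENNReal.toReal_one] at h

theorem toReal_nonneg {α : Type*} (p : PMF α) (a : α) : 0 ≤ (p a).toReal := ENNReal.toReal_nonneg

theorem hasSum_map_toReal {α β : Type*} [DecidableEq β] (p : PMF α) (f : α → β) (b : β) :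
    HasSum (fun a => if f a = b then (p a).toReal else 0) (p.map f b).toReal := by
  have h1 : ∑' a, (if f a = b then p a else 0) = p.map f b := by
    rw [PMF.map_apply]
    refine tsum_congr fun a => ?_
    by_cases h : f a = b
    · rw [if_pos h, if_pos h.symm]
    · rw [if_neg h, if_neg (Ne.symm h)]
  have h2 := ENNReal.hasSum_toReal (f := fun a => if f a = b then p a else 0)
    (by rw [h1]; exact (p.map f).apply_ne_top b)
  rw [← ENNReal.tsum_toReal_eq, h1] at h2
  · convert h2 using 2 with a
    split_ifs <;> simp
  · intro a
    split_ifs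
    · exact p.apply_ne_top a
    · simp

theorem hasSum_mul_comp {α β : Type*} [Fintype β] (p : PMF α) (f : α → β) (φ : β → ℝ) :
    HasSum (fun a => (p a).toReal * φ (f a)) (∑ b, (p.map f b).toReal * φ b) := by
  classical
  have h : HasSum (fun a => ∑ b, (if f a = b then (p a).toReal else 0) * φ b)
      (∑ b, (p.map f b).toReal * φ b) :=
    hasSum_sum fun b _ => (p.hasSum_map_toReal f b).mul_right (φ b)
  convert h using 2 with a
  simp [ite_mul]

theorem map_snd_toReal {A B : Type*} [Fintype A] (q : PMF (A × B)) (b : B) :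
    (q.map Prod.snd b).toReal = ∑ a, (q (a, b)).toReal := by
  classical
  refine (q.hasSum_map_toReal Prod.snd b).unique ?_
  have h : HasSum (fun a => ∑ a', if a = (a', b) then (q (a', b)).toReal else 0)
      (∑ a, (q (a, b)).toReal) := by
    refine hasSum_sum fun a' _ => ?_
    exact hasSum_ite_eq (a', b) _
  convert h using 2 with s
  obtain ⟨a, b'⟩ := s
  by_cases hb : b' = b
  · subst hb
    simp
  · simp [hb]

theorem le_map_snd_toReal {A B : Type*} [Fintype A] (q : PMF (A × B)) (a : A) (b : B) :
    (q (a, b)).toReal ≤ (q.map Prod.snd b).toReal := by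
  rw [map_snd_toReal]
  exact Finset.single_le_sum (f := fun a => (q (a, b)).toReal) (fun i _ => q.toReal_nonneg _)
    (Finset.mem_univ a)

end PMF

/-! ### Entropy as an absolutely convergent series -/

theorem abs_mul_logb_div_le {g G : ℝ} (hg : 0 ≤ g) (hgG : g ≤ G) :
    |g * Real.logb 2 (G / g)| ≤ G / Real.log 2 := by
  have hl : 0 < Real.log 2 := Real.log_pos one_lt_two
  rcases hg.eq_or_lt with rfl | hg
  · simpa using div_nonneg hgG hl.le
  · have h1 : 1 ≤ G / g := (one_le_div hg).2 hgG
    have h2 : 0 ≤ Real.logb 2 (G / g) := Real.logb_nonneg one_lt_two h1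
    rw [abs_of_nonneg (mul_nonneg hg.le h2), Real.logb, ← mul_div_assoc]
    gcongr
    have h3 := Real.log_le_sub_one_of_pos (lt_of_lt_of_le one_pos h1)
    calc g * Real.log (G / g) ≤ g * (G / g) :=
          mul_le_mul_of_nonneg_left (by linarith) hg.le
      _ = G := by field_simp

/-- Since g log₂(G/g) ≤ G / ln 2, the marginal of `B`, repeated once for each element of the finite
`A`, dominates the terms; `B` may be infinite, as the type of transcripts is. -/
theorem hasSum_condEntropy {A B : Type*} [Fintype A] (q : PMF (A × B)) :
    HasSum (fun s : A × B => (q s).toReal *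
      Real.logb 2 ((q.map Prod.snd s.2).toReal / (q s).toReal)) (condEntropy q) := by
  have hsum : Summable (fun s : A × B => (q s).toReal *
      Real.logb 2 ((q.map Prod.snd s.2).toReal / (q s).toReal)) := by
    have hS : Summable fun s : A × B => (q.map Prod.snd s.2).toReal / Real.log 2 := by
      refine Summable.div_const ?_ _
      rw [← (Equiv.prodComm B A).summable_iff]
      refine (summable_prod_of_nonneg fun s => (q.map Prod.snd).toReal_nonneg _).2 ⟨?_, ?_⟩
      · intro b
        exact (hasSum_fintype _).summable
      · simpa using (q.map Prod.snd).hasSum_toReal.summable.mul_left (Fintype.card A : ℝ)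
    refine Summable.of_norm_bounded hS fun s => ?_
    exact abs_mul_logb_div_le (q.toReal_nonneg s) (q.le_map_snd_toReal s.1 s.2)
  have h : ∑' s : A × B, (q s).toReal *
      Real.logb 2 ((q.map Prod.snd s.2).toReal / (q s).toReal) = condEntropy q := by
    rw [condEntropy, ← (Equiv.prodComm B A).tsum_eq, Summable.tsum_prod]
    · refine tsum_congr fun b => ?_
      rw [tsum_fintype, Finset.mul_sum]
      refine Finset.sum_congr rfl fun a _ => ?_
      simp only [Equiv.prodComm_apply, Prod.swap_prod_mk]
      have h0 := q.le_map_snd_toReal a b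
      have h1 := q.toReal_nonneg (a, b)
      rcases (h1.trans h0).eq_or_lt with h2 | h2
      · have h3 : (q (a, b)).toReal = 0 := le_antisymm (by rw [h2]; exact h0) h1
        simp [h3]
      · rw [one_div_div, ← mul_assoc, mul_div_cancel₀ _ h2.ne']
    · exact (Equiv.prodComm B A).summable_iff.2 hsum
  exact h ▸ hsum.hasSum

/-! ### Mutual information as a mean log-likelihood ratio -/

section MutualInfo

variable {A B C : Type*}

/-- The joint probability of the first and the last coordinate. -/
noncomputable def pmfFst (q : PMF (A × B × C)) (a : A) (c : C) : ℝ :=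
  (q.map (fun s => (s.1, s.2.2)) (a, c)).toReal

/-- The joint probability of the second and the last coordinate. -/
noncomputable def pmfMid (q : PMF (A × B × C)) (b : B) (c : C) : ℝ :=
  (q.map Prod.snd (b, c)).toReal

/-- The probability of the last coordinate. -/
noncomputable def pmfLast (q : PMF (A × B × C)) (c : C) : ℝ :=
  (q.map (fun s => s.2.2) c).toReal

theorem pmfFst_nonneg (q : PMF (A × B × C)) (a : A) (c : C) : 0 ≤ pmfFst q a c :=
  ENNReal.toReal_nonneg

theorem pmfMid_nonneg (q : PMF (A × B × C)) (b : B) (c : C) : 0 ≤ pmfMid q b c :=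
  ENNReal.toReal_nonneg

theorem pmfLast_nonneg (q : PMF (A × B × C)) (c : C) : 0 ≤ pmfLast q c :=
  ENNReal.toReal_nonneg

theorem sum_pmfFst [Fintype A] (q : PMF (A × B × C)) (c : C) : ∑ a, pmfFst q a c = pmfLast q c := by
  unfold pmfFst pmfLast
  rw [← PMF.map_snd_toReal, PMF.map_comp]
  rfl

theorem pmfFst_le [Fintype A] (q : PMF (A × B × C)) (a : A) (c : C) : pmfFst q a c ≤ pmfLast q c := by
  rw [← sum_pmfFst]
  exact Finset.single_le_sum (fun i _ => pmfFst_nonneg q i c) (Finset.mem_univ a)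

theorem le_pmfMid [Fintype A] (q : PMF (A × B × C)) (s : A × B × C) :
    (q s).toReal ≤ pmfMid q s.2.1 s.2.2 :=
  q.le_map_snd_toReal s.1 s.2

theorem le_pmfFst (q : PMF (A × B × C)) (s : A × B × C) :
    (q s).toReal ≤ pmfFst q s.1 s.2.2 := by
  classical
  have h := q.hasSum_map_toReal (fun s => (s.1, s.2.2)) (s.1, s.2.2)
  refine le_trans (le_of_eq ?_) (le_hasSum h s fun i _ => ?_)
  · simp
  · split_ifs
    · exact q.toReal_nonneg i
    · exact le_rfl

theorem hasSum_pmfMid (q : PMF (A × B × C)) :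
    HasSum (fun s : B × C => pmfMid q s.1 s.2) 1 :=
  (q.map Prod.snd).hasSum_toReal

theorem hasSum_condMutualInfo [Fintype A] [Fintype C] (q : PMF (A × B × C)) :
    HasSum (fun s : A × B × C => (q s).toReal *
      Real.logb 2 ((q s).toReal * pmfLast q s.2.2 /
        (pmfFst q s.1 s.2.2 * pmfMid q s.2.1 s.2.2))) (condMutualInfo q) := by
  have h1 := hasSum_condEntropy q
  have h2 : HasSum (fun s : A × B × C => (q s).toReal *
      Real.logb 2 (pmfLast q s.2.2 / pmfFst q s.1 s.2.2))
      (condEntropy (q.map fun s => (s.1, s.2.2))) := by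
    have h3 := hasSum_condEntropy (q.map fun s => (s.1, s.2.2))
    have h4 := q.hasSum_mul_comp (fun s => (s.1, s.2.2))
      (fun s => Real.logb 2 (pmfLast q s.2 / pmfFst q s.1 s.2))
    rw [h3.unique (hasSum_fintype _)]
    convert h4 using 1
    refine Finset.sum_congr rfl fun s _ => ?_
    unfold pmfLast pmfFst
    rw [PMF.map_comp]
    rfl
  refine (h2.sub h1).congr_fun fun s => ?_
  rw [← mul_sub]
  have hq := q.toReal_nonneg s
  rcases hq.eq_or_lt with h | h
  · rw [← h]; simp
  · have ha := lt_of_lt_of_le h (le_pmfFst q s)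
    have hb := lt_of_lt_of_le h (le_pmfMid q s)
    have hc := lt_of_lt_of_le ha (pmfFst_le q s.1 s.2.2)
    change _ = (q s).toReal * (_ - Real.logb 2 (pmfMid q s.2.1 s.2.2 / (q s).toReal))
    rw [← Real.logb_div (by positivity) (by positivity)]
    congr 2
    field_simp

theorem hasSum_swap_fintype {A E : Type*} [Fintype A] {f : A × E → ℝ} {g : E → ℝ} {c : ℝ}
    (hf : ∀ s, 0 ≤ f s) (hg : ∀ e, ∑ a, f (a, e) = g e) (hs : HasSum g c) : HasSum f c := by
  have hsum : Summable (f ∘ Equiv.prodComm E A) := by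
    refine (summable_prod_of_nonneg fun s => hf _).2 ⟨fun e => (hasSum_fintype _).summable, ?_⟩
    simpa [hg] using hs.summable
  rw [← (Equiv.prodComm E A).hasSum_iff]
  have h := hsum.tsum_prod
  simp only [tsum_fintype, Function.comp_apply, Equiv.prodComm_apply, Prod.swap_prod_mk, hg,
    hs.tsum_eq] at h
  have h' := hsum.hasSum
  change HasSum _ (∑' s, f (Equiv.prodComm E A s)) at h'
  rwa [← h]

/-- The probabilities in `q`, restricted to the points where the likelihood ratio exceeds `M`. -/
noncomputable def likelihoodTail (q : PMF (A × B × C)) (M : ℝ) (s : A × B × C) : ℝ :=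
  if M * (pmfFst q s.1 s.2.2 * pmfMid q s.2.1 s.2.2) < (q s).toReal * pmfLast q s.2.2
    then (q s).toReal else 0

theorem likelihoodTail_nonneg (q : PMF (A × B × C)) (M : ℝ) (s : A × B × C) :
    0 ≤ likelihoodTail q M s := by
  unfold likelihoodTail
  split_ifs
  exacts [q.toReal_nonneg s, le_rfl]

theorem likelihoodTail_le (q : PMF (A × B × C)) (M : ℝ) (s : A × B × C) :
    likelihoodTail q M s ≤ (q s).toReal := by
  unfold likelihoodTail
  split_ifs
  exacts [le_rfl, q.toReal_nonneg s]

theorem summable_likelihoodTail (q : PMF (A × B × C)) (M : ℝ) :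
    Summable (likelihoodTail q M) :=
  Summable.of_nonneg_of_le (likelihoodTail_nonneg q M) (likelihoodTail_le q M)
    q.hasSum_toReal.summable

/-- The log-likelihood ratio exceeds `logb 2 M` only with small probability. -/
theorem logb_mul_tail_le_condMutualInfo [Fintype A] [Fintype C] (q : PMF (A × B × C)) {M : ℝ}
    (hM : 1 ≤ M) :
    Real.logb 2 M * ∑' s, likelihoodTail q M s ≤ condMutualInfo q + 1 / Real.log 2 := by
  classical
  have hl : 0 < Real.log 2 := Real.log_pos one_lt_two
  have hI := hasSum_condMutualInfo q
  -- The law making A and B independent given C has mass 1. On the support of `q` its density with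
  -- respect to `q` is the inverse r⁻¹ of the likelihood ratio r.
  have hS : HasSum (fun s : A × B × C =>
      pmfFst q s.1 s.2.2 * pmfMid q s.2.1 s.2.2 / pmfLast q s.2.2) 1 := by
    refine hasSum_swap_fintype (fun s => ?_) (fun e => ?_) (hasSum_pmfMid q)
    · exact div_nonneg (mul_nonneg (pmfFst_nonneg _ _ _) (pmfMid_nonneg _ _ _))
        (pmfLast_nonneg _ _)
    · simp only
      rw [← Finset.sum_div, ← Finset.sum_mul, sum_pmfFst]
      rcases (pmfLast_nonneg q e.2).eq_or_lt with h | h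
      · rw [← h]
        have : pmfMid q e.1 e.2 = 0 := by
          rw [pmfMid, PMF.map_snd_toReal]
          refine Finset.sum_eq_zero fun a _ => le_antisymm ?_ (q.toReal_nonneg _)
          exact (le_pmfFst q (a, e)).trans ((pmfFst_le q a e.2).trans h.symm.le)
        simp [this]
      · field_simp
  -- Terms log₂ r may be negative. Adding r⁻¹ / ln 2 makes them nonnegative, because ln r ≥ 1 - r⁻¹,
  -- and costs 1 / ln 2 in total; Markov's argument then applies.
  have hR := hI.add (hS.mul_right (1 / Real.log 2))
  rw [one_mul] at hR
  refine hasSum_le (fun s => ?_) ((summable_likelihoodTail q M).hasSum.mul_left (Real.logb 2 M)) hR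
  unfold likelihoodTail
  have hM' : 0 < M := by linarith
  rcases (q.toReal_nonneg s).eq_or_lt with h | h
  · rw [← h]
    simp only [ite_self, mul_zero, zero_mul, zero_add]
    exact mul_nonneg (div_nonneg (mul_nonneg (pmfFst_nonneg _ _ _) (pmfMid_nonneg _ _ _))
        (pmfLast_nonneg _ _)) (by positivity)
  · have ha := lt_of_lt_of_le h (le_pmfFst q s)
    have hb := lt_of_lt_of_le h (le_pmfMid q s)
    have hc := lt_of_lt_of_le ha (pmfFst_le q s.1 s.2.2)
    set g := (q s).toReal
    set a := pmfFst q s.1 s.2.2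
    set b := pmfMid q s.2.1 s.2.2
    set c := pmfLast q s.2.2
    have hr : 0 < g * c / (a * b) := by positivity
    have e : a * b / c * (1 / Real.log 2) = g * ((g * c / (a * b))⁻¹ / Real.log 2) := by
      field_simp
    rw [e, ← mul_add]
    set r := g * c / (a * b)
    have h1 : M * (a * b) < g * c ↔ M < r := (lt_div_iff₀ (by positivity)).symm
    simp only [h1]
    split_ifs with h2
    · rw [mul_comm]
      refine mul_le_mul_of_nonneg_left ?_ h.le
      have := Real.logb_le_logb_of_le one_lt_two hM' h2.le
      have : 0 ≤ r⁻¹ / Real.log 2 := by positivity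
      linarith
    · rw [mul_zero]
      refine mul_nonneg h.le ?_
      rw [Real.logb, ← add_div]
      refine div_nonneg ?_ hl.le
      have := Real.one_sub_inv_le_log_of_pos hr
      linarith

/-- The hypothesis bounds the likelihood ratio by W(b,c) / p(b,c), whose mean is at most the mass of
`W`. Jensen's inequality, in the form of the tangent ln r ≤ ln K - 1 + r/K, gives the claim. -/
theorem condMutualInfo_le_logb [Fintype A] [Fintype C] (q : PMF (A × B × C)) (W : B × C → ℝ) {K S : ℝ}
    (hK : 0 < K) (hW : ∀ e, 0 ≤ W e) (hS : HasSum W S) (hSK : S ≤ K)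
    (h : ∀ s, (q s).toReal * pmfLast q s.2.2 ≤ pmfFst q s.1 s.2.2 * W s.2) :
    condMutualInfo q ≤ Real.logb 2 K := by
  have hl : 0 < Real.log 2 := Real.log_pos one_lt_two
  have hI := hasSum_condMutualInfo q
  have hS' : HasSum (fun s : A × B × C => (q s).toReal * (W s.2 / pmfMid q s.2.1 s.2.2))
      (∑' e : B × C, if pmfMid q e.1 e.2 = 0 then 0 else W e) := by
    refine hasSum_swap_fintype (g := fun e => if pmfMid q e.1 e.2 = 0 then 0 else W e)
      (fun s => ?_) (fun e => ?_) ?_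
    · exact mul_nonneg (q.toReal_nonneg s) (div_nonneg (hW _) (pmfMid_nonneg _ _ _))
    · simp only
      rw [← Finset.sum_mul, ← PMF.map_snd_toReal]
      change pmfMid q e.1 e.2 * _ = _
      split_ifs with h0
      · simp [h0]
      · field_simp
    · refine Summable.hasSum (Summable.of_nonneg_of_le (fun e => ?_) (fun e => ?_) hS.summable)
      · split_ifs
        exacts [le_rfl, hW e]
      · split_ifs
        exacts [hW e, le_rfl]
  have hle : ∑' e : B × C, (if pmfMid q e.1 e.2 = 0 then 0 else W e) ≤ S := by
    refine tsum_le_of_sum_le' ?_ fun F => ?_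
    · exact hS.nonneg hW
    · refine (Finset.sum_le_sum fun e _ => ?_).trans (sum_le_hasSum F (fun e _ => hW e) hS)
      split_ifs
      exacts [hW e, le_rfl]
  have key := hasSum_le (fun s => ?_) hI
    ((q.hasSum_toReal.mul_right (Real.logb 2 K - 1 / Real.log 2)).add
      (hS'.mul_right (1 / (K * Real.log 2))))
  · refine key.trans ?_
    have : (∑' e : B × C, if pmfMid q e.1 e.2 = 0 then 0 else W e) * (1 / (K * Real.log 2))
        ≤ K * (1 / (K * Real.log 2)) :=
      mul_le_mul_of_nonneg_right (hle.trans hSK) (by positivity)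
    have e : K * (1 / (K * Real.log 2)) = 1 / Real.log 2 := by field_simp
    linarith
  · rcases (q.toReal_nonneg s).eq_or_lt with h0 | h0
    · rw [← h0]; simp
    · have ha := lt_of_lt_of_le h0 (le_pmfFst q s)
      have hb := lt_of_lt_of_le h0 (le_pmfMid q s)
      have hc := lt_of_lt_of_le ha (pmfFst_le q s.1 s.2.2)
      have hs := h s
      set g := (q s).toReal
      set a := pmfFst q s.1 s.2.2
      set b := pmfMid q s.2.1 s.2.2
      set c := pmfLast q s.2.2
      have hr : 0 < g * c / (a * b) := by positivity
      rw [mul_assoc, ← mul_add]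
      refine mul_le_mul_of_nonneg_left ?_ h0.le
      have h1 : g * c / (a * b) ≤ W s.2 / b := by
        rw [div_le_div_iff₀ (by positivity) hb]
        nlinarith
      have h2 := Real.log_le_sub_one_of_pos (div_pos hr hK)
      rw [Real.log_div hr.ne' hK.ne'] at h2
      have h3 : g * c / (a * b) / K ≤ W s.2 / b / K := by gcongr
      have e : Real.logb 2 K - 1 / Real.log 2 + W s.2 / b * (1 / (K * Real.log 2)) =
          (Real.log K - 1 + W s.2 / b / K) / Real.log 2 := by
        rw [Real.logb]; field_simp
      rw [e, Real.logb]
      gcongr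
      linarith

end MutualInfo

open scoped ENNReal

/-! ### The product structure of transcript probabilities -/

namespace PrivateProtocol

variable {X Y Z : Type*}

/-- The probability that Alice sends her bits of `l`, given Bob's bits of `l`. -/
noncomputable def aliceWeight : PrivateProtocol X Y Z → X → List Bool → ℝ≥0∞
  | .leaf _, _, [] => 1
  | .leaf _, _, _ :: _ => 0
  | .alice _ _, _, [] => 0
  | .alice send child, x, b :: l => send x b * aliceWeight (child b) x l
  | .bob _ _, _, [] => 0
  | .bob _ child, x, b :: l => aliceWeight (child b) x l

/-- The probability that Bob sends his bits of `l`, given Alice's bits of `l`. -/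
noncomputable def bobWeight : PrivateProtocol X Y Z → Y → List Bool → ℝ≥0∞
  | .leaf _, _, [] => 1
  | .leaf _, _, _ :: _ => 0
  | .alice _ _, _, [] => 0
  | .alice _ child, y, b :: l => bobWeight (child b) y l
  | .bob _ _, _, [] => 0
  | .bob send child, y, b :: l => send y b * bobWeight (child b) y l

/-- The output at the leaf reached by the bits `l`. -/
def output : PrivateProtocol X Y Z → List Bool → Z
  | .leaf z, _ => z
  | .alice _ child, l => output (child l.headI) l.tail
  | .bob _ child, l => output (child l.headI) l.tail

end PrivateProtocol

namespace PMF

theorem map_apply_of_inj {α β : Type*} (p : PMF α) {f : α → β} (hf : Function.Injective f)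
    (a : α) : p.map f (f a) = p a := by
  rw [PMF.map_apply, tsum_eq_single a]
  · simp
  · intro b hb
    rw [if_neg fun h => hb (hf h).symm]

theorem map_apply_eq_zero {α β : Type*} (p : PMF α) {f : α → β} {b : β} (h : ∀ a, f a ≠ b) :
    p.map f b = 0 := by
  rw [PMF.map_apply]
  exact ENNReal.tsum_eq_zero.2 fun a => if_neg (h a).symm

theorem bind_map_cons_nil {β : Type*} (p : PMF β) (P : β → PMF (List β)) :
    (p.bind fun b => (P b).map (b :: ·)) [] = 0 := by
  rw [PMF.bind_apply]
  refine ENNReal.tsum_eq_zero.2 fun b => ?_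
  rw [map_apply_eq_zero _ (fun a => by simp), mul_zero]

theorem bind_map_cons_cons {β : Type*} (p : PMF β) (P : β → PMF (List β)) (b : β) (l : List β) :
    (p.bind fun b => (P b).map (b :: ·)) (b :: l) = p b * P b l := by
  rw [PMF.bind_apply, tsum_eq_single b]
  · rw [map_apply_of_inj _ (List.cons_injective)]
  · intro b' hb
    rw [map_apply_eq_zero _ (fun a => by simp [hb]), mul_zero]

end PMF

namespace PrivateProtocol

variable {X Y Z : Type*}

/-- The rectangle property: each bit depends on its owner's input only, so its probability joins one
of the two factors. Strings that do not end exactly at a leaf have a zero factor. -/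
theorem run_map_fst (r : PrivateProtocol X Y Z) (x : X) (y : Y) (l : List Bool) :
    (r.run x y).map Prod.fst l = r.aliceWeight x l * r.bobWeight y l := by
  induction r generalizing l with
  | leaf z =>
    cases l <;> simp [run, aliceWeight, bobWeight, PMF.pure_map]
  | alice send child ih =>
    have h : ((alice send child).run x y).map Prod.fst =
        (send x).bind fun b => (((child b).run x y).map Prod.fst).map (b :: ·) := by
      rw [run, PMF.map_bind]
      simp only [PMF.map_comp]
      rfl
    rw [h]
    cases l with
    | nil => rw [PMF.bind_map_cons_nil]; simp [aliceWeight]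
    | cons b l => rw [PMF.bind_map_cons_cons, ih, aliceWeight, bobWeight, mul_assoc]
  | bob send child ih =>
    have h : ((bob send child).run x y).map Prod.fst =
        (send y).bind fun b => (((child b).run x y).map Prod.fst).map (b :: ·) := by
      rw [run, PMF.map_bind]
      simp only [PMF.map_comp]
      rfl
    rw [h]
    cases l with
    | nil => rw [PMF.bind_map_cons_nil]; simp [bobWeight]
    | cons b l => rw [PMF.bind_map_cons_cons, ih, aliceWeight, bobWeight, mul_left_comm]

theorem snd_eq_output (r : PrivateProtocol X Y Z) (x : X) (y : Y) :
    ∀ s ∈ (r.run x y).support, s.2 = r.output s.1 := by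
  induction r with
  | leaf z => intro s hs; simp_all [run, output]
  | alice send child ih =>
    intro s hs
    simp only [run, PMF.mem_support_bind_iff, PMF.mem_support_map_iff] at hs
    obtain ⟨b, -, s', hs', rfl⟩ := hs
    simpa [output] using ih b s' hs'
  | bob send child ih =>
    intro s hs
    simp only [run, PMF.mem_support_bind_iff, PMF.mem_support_map_iff] at hs
    obtain ⟨b, -, s', hs', rfl⟩ := hs
    simpa [output] using ih b s' hs'

theorem aliceWeight_le_one (r : PrivateProtocol X Y Z) (x : X) (l : List Bool) :
    r.aliceWeight x l ≤ 1 := by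
  induction r generalizing l with
  | leaf z => cases l <;> simp [aliceWeight]
  | alice send child ih =>
    cases l with
    | nil => simp [aliceWeight]
    | cons b l => exact mul_le_one' (PMF.coe_le_one _ _) (ih b l)
  | bob send child ih =>
    cases l with
    | nil => simp [aliceWeight]
    | cons b l => exact ih b l

theorem bobWeight_le_one (r : PrivateProtocol X Y Z) (y : Y) (l : List Bool) :
    r.bobWeight y l ≤ 1 := by
  induction r generalizing l with
  | leaf z => cases l <;> simp [bobWeight]
  | alice send child ih =>
    cases l with
    | nil => simp [bobWeight]
    | cons b l => exact ih b l
  | bob send child ih =>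
    cases l with
    | nil => simp [bobWeight]
    | cons b l => exact mul_le_one' (PMF.coe_le_one _ _) (ih b l)

end PrivateProtocol

/-! ### Joint laws of inputs and transcript -/

namespace PublicProtocol

variable {X Y Z : Type*}

/-- The joint distribution of Alice's input, the transcript and Bob's input. -/
noncomputable def aliceJoint (π : PublicProtocol X Y Z) (μ : PMF (X × Y)) :
    PMF (X × Transcript X Y Z × Y) :=
  (joint π μ).map fun s => (s.1.1, s.2.1, s.1.2)

/-- The joint distribution of Bob's input, the transcript and Alice's input. -/
noncomputable def bobJoint (π : PublicProtocol X Y Z) (μ : PMF (X × Y)) :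
    PMF (Y × Transcript X Y Z × X) :=
  (joint π μ).map fun s => (s.1.2, s.2.1, s.1.1)

theorem infoCost_eq [Fintype X] [Fintype Y] (π : PublicProtocol X Y Z) (μ : PMF (X × Y)) :
    π.infoCost μ = condMutualInfo (aliceJoint π μ) + condMutualInfo (bobJoint π μ) := rfl

/-- The transcript records the selected tree, so only one term of each mixture survives and the
rectangle property applies to that tree. -/
theorem aliceJoint_apply (π : PublicProtocol X Y Z) (μ : PMF (X × Y)) (x : X)
    (t : Transcript X Y Z) (y : Y) :
    aliceJoint π μ (x, t, y) =
      μ (x, y) * (π t.1 * (t.1.aliceWeight x t.2 * t.1.bobWeight y t.2)) := by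
  have h : aliceJoint π μ = μ.bind fun p => π.bind fun r =>
      ((r.run p.1 p.2).map Prod.fst).map fun l => (p.1, (r, l), p.2) := by
    simp only [aliceJoint, joint, run, PMF.map_bind, PMF.map_comp]
    rfl
  rw [h, PMF.bind_apply, tsum_eq_single (x, y), PMF.bind_apply, tsum_eq_single t.1,
    ← PrivateProtocol.run_map_fst]
  · congr 2
    exact PMF.map_apply_of_inj _ (f := fun l => (x, (t.1, l), y))
      (fun l l' h => by simpa using h) t.2
  · intro r hr
    rw [PMF.map_apply_eq_zero, mul_zero]
    intro l h
    exact hr (by rw [← congrArg (fun s => s.2.1.1) h])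
  · intro p hp
    rw [PMF.bind_apply, ENNReal.tsum_eq_zero.2, mul_zero]
    intro r
    rw [PMF.map_apply_eq_zero, mul_zero]
    intro l h
    refine hp ?_
    simp only [Prod.mk.injEq] at h
    exact Prod.ext h.1 h.2.2

theorem bobJoint_eq_map (π : PublicProtocol X Y Z) (μ : PMF (X × Y)) :
    bobJoint π μ = (aliceJoint π μ).map fun s => (s.2.2, s.2.1, s.1) := by
  rw [aliceJoint, PMF.map_comp]
  rfl

theorem bobJoint_apply (π : PublicProtocol X Y Z) (μ : PMF (X × Y)) (x : X)
    (t : Transcript X Y Z) (y : Y) :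
    bobJoint π μ (y, t, x) = aliceJoint π μ (x, t, y) := by
  rw [bobJoint_eq_map]
  refine PMF.map_apply_of_inj _ (f := fun s : X × Transcript X Y Z × Y => (s.2.2, s.2.1, s.1))
    ?_ (x, t, y)
  rintro ⟨a, b, c⟩ ⟨a', b', c'⟩ h
  simp only [Prod.mk.injEq] at h
  obtain ⟨rfl, rfl, rfl⟩ := h
  rfl

theorem joint_map_fst (π : PublicProtocol X Y Z) (μ : PMF (X × Y)) :
    (joint π μ).map Prod.fst = μ := by
  rw [joint, PMF.map_bind]
  simp only [PMF.map_comp]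
  have : ∀ p : X × Y, (Prod.fst ∘ fun s : Transcript X Y Z × Z => (p, s)) =
    Function.const _ p := fun p => rfl
  simp only [this, PMF.map_const, PMF.bind_pure]

theorem pmfFst_aliceJoint (π : PublicProtocol X Y Z) (μ : PMF (X × Y)) (x : X) (y : Y) :
    pmfFst (aliceJoint π μ) x y = (μ (x, y)).toReal := by
  rw [pmfFst, aliceJoint, PMF.map_comp]
  conv_rhs => rw [← joint_map_fst π μ]
  rfl

theorem pmfFst_bobJoint (π : PublicProtocol X Y Z) (μ : PMF (X × Y)) (x : X) (y : Y) :
    pmfFst (bobJoint π μ) y x = (μ (x, y)).toReal := by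
  rw [pmfFst, bobJoint, PMF.map_comp]
  conv_rhs => rw [← joint_map_fst π μ]
  have : ((fun s : Y × Transcript X Y Z × X => (s.1, s.2.2)) ∘
      fun s : (X × Y) × Transcript X Y Z × Z => (s.1.2, s.2.1, s.1.1)) =
      Prod.swap ∘ Prod.fst := rfl
  rw [this, ← PMF.map_comp]
  congr 1
  exact PMF.map_apply_of_inj _ Prod.swap_injective (x, y)

theorem snd_eq_output_of_mem_support (π : PublicProtocol X Y Z) (μ : PMF (X × Y)) :
    ∀ s ∈ (joint π μ).support, s.2.2 = s.2.1.1.output s.2.1.2 := by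
  intro s hs
  simp only [joint, run, PMF.mem_support_bind_iff, PMF.mem_support_map_iff] at hs
  obtain ⟨p, -, t, ⟨r, -, u, hu, rfl⟩, rfl⟩ := hs
  exact PrivateProtocol.snd_eq_output r _ _ u hu

/-- The tree and the bits determine the leaf, so the output need not be kept as a separate
coordinate. -/
theorem errorProb_eq [DecidableEq Z] (π : PublicProtocol X Y Z) (f : X → Y → Z)
    (μ : PMF (X × Y)) :
    π.errorProb f μ = ∑' s : X × Transcript X Y Z × Y,
      if s.2.1.1.output s.2.1.2 ≠ f s.1 s.2.2 then (aliceJoint π μ s).toReal else 0 := by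
  have h : (joint π μ).toOuterMeasure {s | s.2.2 ≠ f s.1.1 s.1.2} =
      (aliceJoint π μ).toOuterMeasure {s | s.2.1.1.output s.2.1.2 ≠ f s.1 s.2.2} := by
    rw [aliceJoint, PMF.toOuterMeasure_map_apply]
    refine PMF.toOuterMeasure_apply_eq_of_inter_support_eq _ ?_
    ext s
    simp only [Set.mem_inter_iff, Set.mem_ofPred_eq, Set.mem_preimage, and_congr_left_iff]
    intro hs
    rw [snd_eq_output_of_mem_support π μ s hs]
  rw [errorProb, h, PMF.toOuterMeasure_apply, ENNReal.tsum_toReal_eq]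
  · refine tsum_congr fun s => ?_
    by_cases hs : s.2.1.1.output s.2.1.2 ≠ f s.1 s.2.2
    · simp [Set.indicator, hs]
    · simp [Set.indicator, hs]
  · intro s
    exact ne_top_of_le_ne_top ((aliceJoint π μ).apply_ne_top s) (Set.indicator_le_self _ _ s)

theorem length_le_of_commCost_le {π : PublicProtocol X Y Z} {m : ℕ} (h : π.commCost ≤ m)
    (μ : PMF (X × Y)) (s : X × Transcript X Y Z × Y) (hs : aliceJoint π μ s ≠ 0) :
    s.2.1.2.length ≤ m := by
  rw [← PMF.mem_support_iff, aliceJoint, PMF.mem_support_map_iff] at hs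
  obtain ⟨u, hu, rfl⟩ := hs
  simp only [joint, PMF.mem_support_bind_iff, PMF.mem_support_map_iff] at hu
  obtain ⟨p, -, t, ht, rfl⟩ := hu
  simp only [commCost, iSup_le_iff] at h
  exact_mod_cast h p.1 p.2 t ht

end PublicProtocol

/-! ### Communication bounds information -/

/-- The bit strings of length at most `m`. -/
def bitStrings : ℕ → Finset (List Bool)
  | 0 => {[]}
  | m + 1 => insert [] ((bitStrings m).image (List.cons false) ∪
      (bitStrings m).image (List.cons true))

theorem mem_bitStrings {m : ℕ} {l : List Bool} (h : l.length ≤ m) : l ∈ bitStrings m := by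
  induction m generalizing l with
  | zero => simpa [bitStrings] using h
  | succ m ih =>
    rcases l with _ | ⟨b, l⟩
    · simp [bitStrings]
    · have := ih (l := l) (by simpa using h)
      cases b <;> simp [bitStrings, this]

theorem card_bitStrings (m : ℕ) : (bitStrings m).card + 1 ≤ 2 ^ (m + 1) := by
  induction m with
  | zero => simp [bitStrings]
  | succ m ih =>
    have h1 := Finset.card_insert_le ([] : List Bool) ((bitStrings m).image (List.cons false) ∪
      (bitStrings m).image (List.cons true))
    have h2 := Finset.card_union_le ((bitStrings m).image (List.cons false))
      ((bitStrings m).image (List.cons true))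
    have h3 := Finset.card_image_le (s := bitStrings m) (f := List.cons false)
    have h4 := Finset.card_image_le (s := bitStrings m) (f := List.cons true)
    rw [bitStrings]
    omega

theorem hasSum_ite_mem_one {α : Type*} [DecidableEq α] (s : Finset α) :
    HasSum (fun a => if a ∈ s then (1 : ℝ) else 0) (s.card : ℝ) := by
  have h : HasSum (fun a => if a ∈ s then (1 : ℝ) else 0)
      (∑ a ∈ s, if a ∈ s then (1 : ℝ) else 0) :=
    hasSum_sum_of_ne_finset_zero fun a ha => if_neg ha
  rwa [Finset.sum_ite_mem, Finset.inter_self, Finset.sum_const, nsmul_eq_mul, mul_one] at h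

theorem hasSum_pmfLast {A B C : Type*} (q : PMF (A × B × C)) : HasSum (pmfLast q) 1 := by
  unfold pmfLast
  exact PMF.hasSum_toReal _

theorem exists_hasSum_of_length_le (m : ℕ) : ∃ (f : List Bool → ℝ) (S : ℝ), (∀ l, 0 ≤ f l) ∧
    (∀ l, l.length ≤ m → f l = 1) ∧ HasSum f S ∧ S ≤ 2 ^ (m + 1) := by
  refine ⟨fun l => if l ∈ bitStrings m then 1 else 0, (bitStrings m).card, fun l => ?_,
    fun l hl => if_pos (mem_bitStrings hl), hasSum_ite_mem_one _, ?_⟩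
  · dsimp only
    split_ifs <;> norm_num
  · have : ((bitStrings m).card : ℝ) + 1 ≤ 2 ^ (m + 1) := by exact_mod_cast card_bitStrings m
    linarith

/-- Transcripts with at most `m` bits, besides independent public randomness, convey at most
`m + 1` bits of information. -/
theorem condMutualInfo_le_of_length_le {A C R : Type*} [Fintype A] [Fintype C]
    (q : PMF (A × (R × List Bool) × C)) (π : PMF R) (m : ℕ)
    (h : ∀ s, (q s).toReal ≤ pmfFst q s.1 s.2.2 * (π s.2.1.1).toReal)
    (hl : ∀ s, q s ≠ 0 → s.2.1.2.length ≤ m) : condMutualInfo q ≤ m + 1 := by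
  obtain ⟨f, S, h0, hf, h1, hS⟩ := exists_hasSum_of_length_le m
  have h2 : HasSum (pmfLast q) 1 := hasSum_pmfLast q
  have h3 : HasSum (fun e : R × List Bool => (π e.1).toReal * f e.2) (1 * S) :=
    π.hasSum_toReal.mul h1
      (π.hasSum_toReal.summable.mul_of_nonneg h1.summable (fun r => π.toReal_nonneg r) h0)
  have h4 : HasSum (fun e : (R × List Bool) × C =>
      ((π e.1.1).toReal * f e.1.2) * pmfLast q e.2) (1 * S * 1) :=
    h3.mul h2 (h3.summable.mul_of_nonneg h2.summable
      (fun e => mul_nonneg (π.toReal_nonneg _) (h0 _)) (fun c => pmfLast_nonneg q c))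
  have hW : ∀ e : (R × List Bool) × C,
      0 ≤ ((π e.1.1).toReal * f e.1.2) * pmfLast q e.2 := fun e =>
    mul_nonneg (mul_nonneg (π.toReal_nonneg _) (h0 _)) (pmfLast_nonneg q _)
  -- The dominating weight ignores the first coordinate: public coins, times counting measure on
  -- strings of length at most `m`, times the law of the last coordinate. Its mass is at most `2 ^
  -- (m + 1)`.
  have key : condMutualInfo q ≤ Real.logb 2 (2 ^ (m + 1)) := by
    refine condMutualInfo_le_logb q (fun e : (R × List Bool) × C =>
      ((π e.1.1).toReal * f e.1.2) * pmfLast q e.2)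
      (by positivity) hW h4 (by rwa [one_mul, mul_one]) fun s => ?_
    by_cases hs : q s = 0
    · rw [hs, ENNReal.toReal_zero, zero_mul]
      exact mul_nonneg (pmfFst_nonneg _ _ _) (hW _)
    · rw [hf _ (hl s hs), mul_one, ← mul_assoc]
      exact mul_le_mul_of_nonneg_right (h s) (pmfLast_nonneg q _)
  refine key.trans (le_of_eq ?_)
  rw [Real.logb_pow, Real.logb_self_eq_one one_lt_two]
  push_cast
  ring

theorem PublicProtocol.infoCost_le_of_commCost_le {X Y Z : Type*} [Fintype X] [Fintype Y]
    {π : PublicProtocol X Y Z} {m : ℕ} (h : π.commCost ≤ m) (μ : PMF (X × Y)) :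
    π.infoCost μ ≤ 2 * (m + 1) := by
  have hle : ∀ x t y, (aliceJoint π μ (x, t, y)).toReal ≤ (μ (x, y)).toReal * (π t.1).toReal := by
    intro x t y
    rw [aliceJoint_apply, ENNReal.toReal_mul, ENNReal.toReal_mul]
    refine mul_le_mul_of_nonneg_left ?_ ENNReal.toReal_nonneg
    refine mul_le_of_le_one_right ENNReal.toReal_nonneg ?_
    refine ENNReal.toReal_le_of_le_ofReal zero_le_one ?_
    simpa using mul_le_one' (t.1.aliceWeight_le_one x t.2) (t.1.bobWeight_le_one y t.2)
  have h1 : condMutualInfo (aliceJoint π μ) ≤ m + 1 := by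
    refine condMutualInfo_le_of_length_le _ π m (fun s => ?_)
      (fun s hs => length_le_of_commCost_le h μ s hs)
    rw [pmfFst_aliceJoint]
    exact hle s.1 s.2.1 s.2.2
  have h2 : condMutualInfo (bobJoint π μ) ≤ m + 1 := by
    refine condMutualInfo_le_of_length_le _ π m (fun s => ?_)
      (fun s hs => length_le_of_commCost_le h μ (s.2.2, s.2.1, s.1) ?_)
    · rw [pmfFst_bobJoint]
      refine le_trans (le_of_eq ?_) (hle s.2.2 s.2.1 s.1)
      rw [← bobJoint_apply]
    · rwa [← bobJoint_apply]
  rw [infoCost_eq]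
  linarith

/-! ### Bilinear discrepancy bounds and min-kernels -/

/-- The bilinear form `w` is bounded by the diagonal quadratic forms `p` and `q`. -/
def BilinearBound {X Y : Type*} [Fintype X] [Fintype Y] (w : X → Y → ℝ) (p : X → ℝ)
    (q : Y → ℝ) : Prop :=
  ∀ (u : X → ℝ) (v : Y → ℝ),
    ∑ x, ∑ y, w x y * (u x * v y) ≤ ∑ x, p x * u x ^ 2 + ∑ y, q y * v y ^ 2

theorem integral_sum_mul_indicator_Ioo {ι : Type*} [Fintype ι] (c r : ι → ℝ) (hr : ∀ i, 0 ≤ r i) :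
    MeasureTheory.Integrable (fun a => ∑ i, c i * (Set.Ioo 0 (r i)).indicator 1 a) ∧
      ∫ a, ∑ i, c i * (Set.Ioo 0 (r i)).indicator 1 a = ∑ i, c i * r i := by
  have h : ∀ i, MeasureTheory.Integrable (fun a : ℝ =>
      c i * (Set.Ioo 0 (r i)).indicator (1 : ℝ → ℝ) a) := by
    intro i
    refine MeasureTheory.Integrable.const_mul ?_ _
    refine (MeasureTheory.integrable_indicator_iff measurableSet_Ioo).2 ?_
    exact (MeasureTheory.integrableOn_const (by simp) : MeasureTheory.IntegrableOn
      (fun _ : ℝ => (1 : ℝ)) (Set.Ioo 0 (r i)))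
  refine ⟨MeasureTheory.integrable_finsetSum _ fun i _ => h i, ?_⟩
  rw [MeasureTheory.integral_finsetSum _ fun i _ => h i]
  refine Finset.sum_congr rfl fun i _ => ?_
  rw [MeasureTheory.integral_const_mul, MeasureTheory.integral_indicator_one measurableSet_Ioo,
    Real.volume_real_Ioo_of_le (hr i), sub_zero]

/-- Layer-cake: a nonnegative `r` is the integral over `a` of the indicator of `a ∈ (0, r)`, so an
inequality at every level integrates. -/
theorem sum_mul_le_sum_mul_of_indicator {ι κ : Type*} [Fintype ι] [Fintype κ] (c r : ι → ℝ)
    (d s : κ → ℝ) (hr : ∀ i, 0 ≤ r i) (hs : ∀ j, 0 ≤ s j)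
    (h : ∀ a : ℝ, ∑ i, c i * (Set.Ioo 0 (r i)).indicator 1 a ≤
      ∑ j, d j * (Set.Ioo 0 (s j)).indicator 1 a) :
    ∑ i, c i * r i ≤ ∑ j, d j * s j := by
  obtain ⟨h1, h2⟩ := integral_sum_mul_indicator_Ioo c r hr
  obtain ⟨h3, h4⟩ := integral_sum_mul_indicator_Ioo d s hs
  rw [← h2, ← h4]
  exact MeasureTheory.integral_mono h1 h3 h

/-- The kernel `min (s x) (t y)` is an inner product of vectors of squared norms `s x`, `t y`. -/
theorem BilinearBound.mul_min {X Y : Type*} [Fintype X] [Fintype Y] {w : X → Y → ℝ} {p : X → ℝ}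
    {q : Y → ℝ} (h : BilinearBound w p q) {s : X → ℝ} {t : Y → ℝ} (hs : ∀ x, 0 ≤ s x)
    (ht : ∀ y, 0 ≤ t y) :
    BilinearBound (fun x y => w x y * min (s x) (t y)) (fun x => p x * s x)
      (fun y => q y * t y) := by
  intro u v
  have key := sum_mul_le_sum_mul_of_indicator (ι := X × Y) (κ := X ⊕ Y)
    (fun e => w e.1 e.2 * (u e.1 * v e.2)) (fun e => min (s e.1) (t e.2))
    (Sum.elim (fun x => p x * u x ^ 2) (fun y => q y * v y ^ 2)) (Sum.elim s t)
    (fun e => le_min (hs _) (ht _)) (by rintro (x | y) <;> simp [hs, ht]) (fun a => ?_)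
  · simp only [Fintype.sum_prod_type, Fintype.sum_sum_type, Sum.elim_inl, Sum.elim_inr] at key
    convert key using 1
    · refine Finset.sum_congr rfl fun x _ => Finset.sum_congr rfl fun y _ => by ring
    · congr 1
      · exact Finset.sum_congr rfl fun x _ => by ring
      · exact Finset.sum_congr rfl fun x _ => by ring
  -- At level `a` the kernel min(s, t) is the product of the indicators of a < s(x) and a < t(y).
  -- These are absorbed into the test vectors, where squaring leaves them unchanged.
  · have := h (fun x => u x * (Set.Ioo 0 (s x)).indicator 1 a)
      (fun y => v y * (Set.Ioo 0 (t y)).indicator 1 a)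
    simp only [Fintype.sum_prod_type, Fintype.sum_sum_type, Sum.elim_inl, Sum.elim_inr]
    convert this using 1
    · refine Finset.sum_congr rfl fun x _ => Finset.sum_congr rfl fun y _ => ?_
      rw [← Set.Ioo_inter_Ioo.trans (by rw [sup_idem] :
        Set.Ioo (0 ⊔ 0) (s x ⊓ t y) = Set.Ioo 0 (min (s x) (t y))),
        Set.inter_indicator_one, Pi.mul_apply]
      ring
    · congr 1
      · refine Finset.sum_congr rfl fun x _ => ?_
        by_cases hx : a ∈ Set.Ioo 0 (s x) <;> simp [hx]
      · refine Finset.sum_congr rfl fun x _ => ?_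
        by_cases hx : a ∈ Set.Ioo 0 (t x) <;> simp [hx]

/-! ### Finite expectations under mixtures -/

namespace PMF

theorem sum_bind_toReal {α β : Type*} [Fintype α] [Fintype β] (p : PMF α) (f : α → PMF β)
    (F : β → ℝ) : ∑ b, (p.bind f b).toReal * F b =
      ∑ a, (p a).toReal * ∑ b, (f a b).toReal * F b := by
  simp only [PMF.bind_apply, tsum_fintype, Finset.mul_sum]
  rw [Finset.sum_comm]
  refine Finset.sum_congr rfl fun b _ => ?_
  rw [ENNReal.toReal_sum fun a _ => ENNReal.mul_ne_top (p.apply_ne_top a) ((f a).apply_ne_top b),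
    Finset.sum_mul]
  refine Finset.sum_congr rfl fun a _ => ?_
  rw [ENNReal.toReal_mul, mul_assoc]

theorem sum_pure_toReal {β : Type*} [Fintype β] (b : β) (F : β → ℝ) :
    ∑ b', ((PMF.pure b) b').toReal * F b' = F b := by
  classical
  rw [Finset.sum_eq_single b]
  · simp
  · intro b' _ hb
    simp [PMF.pure_apply, hb]
  · simp

theorem sum_uniform_bind_toReal {α β : Type*} [Fintype α] [Nonempty α] [Fintype β]
    (f : α → PMF β) (F : β → ℝ) :
    ∑ b, ((PMF.uniformOfFintype α).bind f b).toReal * F b =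
      (∑ a, ∑ b, (f a b).toReal * F b) / Fintype.card α := by
  rw [sum_bind_toReal, Finset.sum_div]
  refine Finset.sum_congr rfl fun a _ => ?_
  rw [PMF.uniformOfFintype_apply, ENNReal.toReal_inv, ENNReal.toReal_natCast]
  field_simp

end PMF

/-! ### Prefix martingales and the discrepancy of Greater-Than -/

section Bits

variable {n : ℕ}

/-- The string `z` with its bit at position `k` flipped. -/
def bitFlip (k : Fin n) (z : Fin n → Bool) : Fin n → Bool :=
  fun i => if i = k then !z i else z i

theorem bitFlip_involutive (k : Fin n) : Function.Involutive (bitFlip k) := by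
  intro z
  funext i
  by_cases h : i = k <;> simp [bitFlip, h]

theorem sum_bitFlip (k : Fin n) (F : (Fin n → Bool) → ℝ) :
    ∑ z, F (bitFlip k z) = ∑ z, F z :=
  Equiv.sum_comp (bitFlip_involutive k).toPerm F

theorem sum_eq_sum_bitFlip (k : Fin n) (F : (Fin n → Bool) → ℝ) :
    ∑ z, F z = ∑ z, (F z + F (bitFlip k z)) / 2 := by
  rw [← Finset.sum_div, Finset.sum_add_distrib, sum_bitFlip]
  ring

/-- The string that agrees with `z` before position `k` and with `u` from there on. -/
def splice (k : ℕ) (z u : Fin n → Bool) : Fin n → Bool :=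
  fun i => if (i : ℕ) < k then z i else u i

/-- The average of `f` over the strings that agree with `z` before position `k`. -/
noncomputable def prefixAvg (f : (Fin n → Bool) → ℝ) (k : ℕ) (z : Fin n → Bool) : ℝ :=
  (∑ u, f (splice k z u)) / 2 ^ n

theorem prefixAvg_of_le (f : (Fin n → Bool) → ℝ) {k : ℕ} (hk : n ≤ k) : prefixAvg f k = f := by
  funext z
  have : ∀ u, splice k z u = z := fun u => funext fun i => if_pos (i.2.trans_le hk)
  simp [prefixAvg, this]

/-- Pairing each tail `u` with its flip at `k` makes bit `k` take both values once; one of them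
matches `z`, the other its flip. -/
theorem prefixAvg_eq (f : (Fin n → Bool) → ℝ) (k : Fin n) (z : Fin n → Bool) :
    prefixAvg f k z = (prefixAvg f (k + 1) z + prefixAvg f (k + 1) (bitFlip k z)) / 2 := by
  unfold prefixAvg
  rw [← add_div, ← Finset.sum_add_distrib, sum_eq_sum_bitFlip k, ← Finset.sum_div, div_right_comm]
  congr 2
  refine Finset.sum_congr rfl fun u _ => ?_
  have h1 : ∀ z : Fin n → Bool, u k = z k → splice k z u = splice (k + 1) z u := by
    intro z hz
    funext i
    rcases lt_trichotomy (i : ℕ) k with h | h | h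
    · simp [splice, h, h.trans (Nat.lt_succ_self _)]
    · have : i = k := Fin.ext h
      subst this
      simp [splice, hz]
    · have h' : ¬ (i : ℕ) < k + 1 := by omega
      simp [splice, h.not_gt, h']
  have h2 : ∀ z : Fin n → Bool, splice (k + 1) z (bitFlip k u) = splice (k + 1) z u := by
    intro z
    funext i
    by_cases h : i = k <;> simp [splice, bitFlip, h]
  have h3 : ∀ u z : Fin n → Bool, splice k (bitFlip k z) u = splice k z u := by
    intro u z
    funext i
    by_cases h : i = k <;> simp [splice, bitFlip, h]
  by_cases hz : u k = z k
  · rw [h1 z hz, ← h3 (bitFlip k u), ← h2 (bitFlip k z)]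
    congr 2
    funext i
    rcases lt_trichotomy (i : ℕ) k with h | h | h
    · simp [splice, h, h.trans (Nat.lt_succ_self _)]
    · have : i = k := Fin.ext h
      subst this
      simp [splice, bitFlip, hz]
    · have h' : ¬ (i : ℕ) < k + 1 := by omega
      simp [splice, h.not_gt, h']
  · have hz' : u k = bitFlip k z k := by
      simp only [bitFlip, if_true]
      revert hz
      cases u k <;> cases z k <;> simp
    rw [← h3 u, h1 _ hz', add_comm]
    congr 2
    rw [← h2 z]
    funext i
    rcases lt_trichotomy (i : ℕ) k with h | h | h
    · simp [splice, h, h.trans (Nat.lt_succ_self _)]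
    · have : i = k := Fin.ext h
      subst this
      simp [splice, bitFlip, hz']
    · have h' : ¬ (i : ℕ) < k + 1 := by omega
      simp [splice, h.not_gt, h']

theorem sum_prefixAvg (f : (Fin n → Bool) → ℝ) (k : ℕ) : ∑ z, prefixAvg f k z = ∑ z, f z := by
  by_cases hk : n ≤ k
  · rw [prefixAvg_of_le f hk]
  · have h : ∀ j, j ≤ n → ∑ z, prefixAvg f (n - j) z = ∑ z, f z := by
      intro j
      induction j with
      | zero => intro _; rw [prefixAvg_of_le f (by omega)]
      | succ j ih =>
        intro hj
        have e : n - j = (n - (j + 1)) + 1 := by omega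
        rw [← ih (by omega), sum_eq_sum_bitFlip ⟨n - (j + 1), by omega⟩ (prefixAvg f (n - j)), e]
        exact Finset.sum_congr rfl fun z _ => prefixAvg_eq f ⟨n - (j + 1), by omega⟩ z
    simpa [Nat.sub_sub_self (not_le.1 hk).le] using h (n - k) (by omega)

/-- The martingale difference at position `k`. -/
noncomputable def prefixDiff (f : (Fin n → Bool) → ℝ) (k : Fin n) (z : Fin n → Bool) : ℝ :=
  (prefixAvg f (k + 1) z - prefixAvg f (k + 1) (bitFlip k z)) / 2

/-- Orthogonality of martingale differences, from the parallelogram identity on the pair `z`,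
`bitFlip k z`. -/
theorem sum_prefixAvg_succ_sq (f : (Fin n → Bool) → ℝ) (k : Fin n) :
    ∑ z, prefixAvg f (k + 1) z ^ 2 =
      ∑ z, prefixAvg f k z ^ 2 + ∑ z, prefixDiff f k z ^ 2 := by
  rw [sum_eq_sum_bitFlip k, ← Finset.sum_add_distrib]
  refine Finset.sum_congr rfl fun z _ => ?_
  rw [prefixAvg_eq, prefixDiff]
  ring

theorem monotone_sum_prefixAvg_sq (f : (Fin n → Bool) → ℝ) :
    Monotone fun k => ∑ z, prefixAvg f k z ^ 2 := by
  refine monotone_nat_of_le_succ fun k => ?_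
  by_cases hk : k < n
  · rw [sum_prefixAvg_succ_sq f ⟨k, hk⟩]
    exact le_add_of_nonneg_right (Finset.sum_nonneg fun z _ => sq_nonneg _)
  · rw [prefixAvg_of_le f (not_lt.1 hk), prefixAvg_of_le f (by omega : n ≤ k + 1)]

theorem sum_prefixAvg_sq_le (f : (Fin n → Bool) → ℝ) (k : ℕ) :
    ∑ z, prefixAvg f k z ^ 2 ≤ ∑ z, f z ^ 2 := by
  refine (monotone_sum_prefixAvg_sq f (le_max_left k n)).trans (le_of_eq ?_)
  simp only [prefixAvg_of_le f (le_max_right k n)]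

theorem sum_prefixDiff_sq_le (f : (Fin n → Bool) → ℝ) :
    ∑ k, ∑ z, prefixDiff f k z ^ 2 ≤ ∑ z, f z ^ 2 := by
  have h1 : ∀ k : Fin n, ∑ z, prefixDiff f k z ^ 2 =
      (fun j : ℕ => ∑ z, prefixAvg f (j + 1) z ^ 2 - ∑ z, prefixAvg f j z ^ 2) k := by
    intro k
    simp only [sum_prefixAvg_succ_sq]
    ring
  rw [Finset.sum_congr rfl fun k _ => h1 k,
    Fin.sum_univ_eq_sum_range (fun j => ∑ z, prefixAvg f (j + 1) z ^ 2 - ∑ z, prefixAvg f j z ^ 2),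
    Finset.sum_range_sub (fun j => ∑ z, prefixAvg f j z ^ 2)]
  have h2 : 0 ≤ ∑ z, prefixAvg f 0 z ^ 2 := Finset.sum_nonneg fun z _ => sq_nonneg _
  linarith [sum_prefixAvg_sq_le f n]

theorem bitsValue_succ (x : Fin (n + 1) → Bool) :
    bitsValue x = (x 0).toNat * 2 ^ n + bitsValue fun i => x i.succ := by
  unfold bitsValue
  rw [Fin.sum_univ_succ]
  simp only [Fin.rev_succ, Fin.val_castSucc, Fin.rev_zero, Fin.val_last]

theorem bitsValue_lt (x : Fin n → Bool) : bitsValue x < 2 ^ n := by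
  induction n with
  | zero => simp [bitsValue]
  | succ n ih =>
    have := ih (fun i => x i.succ)
    rw [bitsValue_succ, pow_succ]
    cases x 0 <;> simp <;> omega

theorem greaterThan_eq {x y : Fin n → Bool} (k : Fin n) (h : ∀ i < k, x i = y i)
    (hk : x k ≠ y k) : greaterThan n x y = x k := by
  induction n with
  | zero => exact k.elim0
  | succ n ih =>
    have hx := bitsValue_lt fun i => x i.succ
    have hy := bitsValue_lt fun i => y i.succ
    refine Fin.cases (motive := fun k => (∀ i < k, x i = y i) → x k ≠ y k →
      greaterThan (n + 1) x y = x k) ?_ ?_ k h hk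
    · intro _ h0
      rw [greaterThan, bitsValue_succ, bitsValue_succ]
      cases hx0 : x 0 <;> cases hy0 : y 0 <;> simp_all <;> omega
    · intro k h hk
      have h0 : x 0 = y 0 := h 0 (Fin.succ_pos k)
      rw [← ih (x := fun i => x i.succ) (y := fun i => y i.succ) k
        (fun i hi => h i.succ (Fin.succ_lt_succ_iff.2 hi)) hk, greaterThan, greaterThan,
        bitsValue_succ x, bitsValue_succ y, h0]
      simp

theorem sum_update_eq (k : Fin n) (z : Fin n → Bool) (G : (Fin n → Bool) → ℝ) :
    ∑ w, G (Function.update z k w) = G z + G (bitFlip k z) := by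
  have h1 : Function.update z k (z k) = z := Function.update_eq_self k z
  have h2 : Function.update z k (!z k) = bitFlip k z := by
    funext i
    by_cases h : i = k
    · subst h; simp [bitFlip]
    · simp [bitFlip, h]
  rw [Fintype.sum_bool, ← h2]
  conv_rhs => rw [← h1]
  simp only [Function.update_self, Function.update_idem]
  cases z k <;> simp [add_comm]

/-- The sampling never uses the bit `z k`, so the independent bit `w` may be stored there; averaging
`z` with its flip accounts for both values of `w`. -/
theorem sum_gtDist_prod [NeZero n] (F : (Fin n → Bool) × (Fin n → Bool) → ℝ) :
    ∑ s, (gtDist n s).toReal * F s = (∑ k : Fin n, (∑ z,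
      (∑ u, ∑ v, F (splice (k + 1) z u, splice (k + 1) (bitFlip k z) v)) /
        2 ^ n / 2 ^ n) / 2 ^ n) / n := by
  have h := fun k : Fin n => fun z => sum_update_eq k z fun z =>
    (∑ u, ∑ v, F (splice (k + 1) z u, splice (k + 1) (bitFlip k z) v)) / 2 ^ n / 2 ^ n
  unfold gtDist
  rw [PMF.sum_uniform_bind_toReal, Fintype.card_fin]
  congr 1
  refine Finset.sum_congr rfl fun k _ => ?_
  rw [PMF.sum_uniform_bind_toReal, Fintype.card_fun, Fintype.card_bool,
    Fintype.card_fin, Nat.cast_pow, Nat.cast_ofNat]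
  congr 1
  rw [sum_eq_sum_bitFlip k fun z => (∑ u, ∑ v, F (splice (k + 1) z u,
    splice (k + 1) (bitFlip k z) v)) / 2 ^ n / 2 ^ n]
  refine Finset.sum_congr rfl fun z _ => ?_
  rw [← h k z, PMF.sum_uniform_bind_toReal, Fintype.card_bool,
    Nat.cast_ofNat]
  congr 1
  refine Finset.sum_congr rfl fun w _ => ?_
  rw [PMF.sum_uniform_bind_toReal, Fintype.card_fun, Fintype.card_bool,
    Fintype.card_fin, Nat.cast_pow, Nat.cast_ofNat]
  congr 1
  rw [Finset.sum_div]
  refine Finset.sum_congr rfl fun u _ => ?_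
  rw [PMF.sum_uniform_bind_toReal, Fintype.card_fun, Fintype.card_bool,
    Fintype.card_fin, Nat.cast_pow, Nat.cast_ofNat]
  congr 1
  refine Finset.sum_congr rfl fun v _ => ?_
  rw [PMF.sum_pure_toReal]
  have e : ∀ (i : Fin n), (i : ℕ) < k + 1 ↔ i < k ∨ i = k := by
    intro i
    rw [Nat.lt_succ_iff, ← Fin.le_def, le_iff_lt_or_eq]
  congr 2 <;> funext i <;> by_cases h1 : i < k <;> by_cases h2 : i = k <;>
    simp_all [splice, bitFlip]

theorem sum_gtDist [NeZero n] (F : (Fin n → Bool) → (Fin n → Bool) → ℝ) :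
    ∑ x, ∑ y, (gtDist n (x, y)).toReal * F x y = (∑ k : Fin n, (∑ z,
      (∑ u, ∑ v, F (splice (k + 1) z u) (splice (k + 1) (bitFlip k z) v)) /
        2 ^ n / 2 ^ n) / 2 ^ n) / n := by
  rw [← Fintype.sum_prod_type' fun x y => (gtDist n (x, y)).toReal * F x y]
  exact sum_gtDist_prod fun s => F s.1 s.2

theorem sum_gtDist_fst [NeZero n] (f : (Fin n → Bool) → ℝ) :
    ∑ x, ∑ y, (gtDist n (x, y)).toReal * f x = (∑ x, f x) / 2 ^ n := by
  rw [sum_gtDist fun x _ => f x]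
  have hn : (n : ℝ) ≠ 0 := Nat.cast_ne_zero.2 (NeZero.ne n)
  have : ∀ k : Fin n, ∑ z, (∑ u, ∑ _v : Fin n → Bool, f (splice (k + 1) z u)) / 2 ^ n / 2 ^ n =
      ∑ x, f x := by
    intro k
    rw [← sum_prefixAvg f (k + 1)]
    refine Finset.sum_congr rfl fun z _ => ?_
    rw [prefixAvg]
    congr 1
    simp [← Finset.mul_sum]
  rw [Finset.sum_congr rfl fun k _ => congrArg (· / (2 : ℝ) ^ n) (this k)]
  simp only [Finset.sum_const, Finset.card_univ, Fintype.card_fin, nsmul_eq_mul]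
  field_simp

theorem sum_gtDist_snd [NeZero n] (f : (Fin n → Bool) → ℝ) :
    ∑ x, ∑ y, (gtDist n (x, y)).toReal * f y = (∑ x, f x) / 2 ^ n := by
  rw [sum_gtDist fun _ y => f y]
  have hn : (n : ℝ) ≠ 0 := Nat.cast_ne_zero.2 (NeZero.ne n)
  have : ∀ k : Fin n, ∑ z, (∑ _u : Fin n → Bool, ∑ v, f (splice (k + 1) (bitFlip k z) v)) /
      2 ^ n / 2 ^ n = ∑ x, f x := by
    intro k
    rw [← sum_prefixAvg f (k + 1), ← sum_bitFlip k]
    refine Finset.sum_congr rfl fun z _ => ?_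
    rw [prefixAvg, bitFlip_involutive k z]
    congr 1
    simp
  rw [Finset.sum_congr rfl fun k _ => congrArg (· / (2 : ℝ) ^ n) (this k)]
  simp only [Finset.sum_const, Finset.card_univ, Fintype.card_fin, nsmul_eq_mul]
  field_simp

/-- The sign `1` for `true`, and `-1` for `false`. -/
def boolSign (b : Bool) : ℝ := if b then 1 else -1

/-- Given `k` and the prefix, the sign is constant and the tails are independent, which leaves a
product of prefix averages at `z` and its flip. Writing these as average ± difference and
antisymmetrizing in bit `k` cancels the average-average and difference-difference terms. -/
theorem sum_gtDist_boolSign [NeZero n] (u v : (Fin n → Bool) → ℝ) :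
    ∑ x, ∑ y, (gtDist n (x, y)).toReal * (boolSign (greaterThan n x y) * (u x * v y)) =
      (∑ k : Fin n, ∑ z, boolSign (z k) * (prefixDiff u k z * prefixAvg v k z -
        prefixAvg u k z * prefixDiff v k z)) / 2 ^ n / n := by
  rw [sum_gtDist fun x y => boolSign (greaterThan n x y) * (u x * v y)]
  congr 1
  rw [Finset.sum_div]
  refine Finset.sum_congr rfl fun k _ => ?_
  congr 1
  have h : ∀ z : Fin n → Bool, (∑ a, ∑ b, boolSign (greaterThan n (splice (k + 1) z a)
      (splice (k + 1) (bitFlip k z) b)) * (u (splice (k + 1) z a) *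
        v (splice (k + 1) (bitFlip k z) b))) / 2 ^ n / 2 ^ n =
      boolSign (z k) * (prefixAvg u (k + 1) z * prefixAvg v (k + 1) (bitFlip k z)) := by
    intro z
    have hg : ∀ a b, greaterThan n (splice (k + 1) z a) (splice (k + 1) (bitFlip k z) b) =
        z k := by
      intro a b
      rw [greaterThan_eq k]
      · simp [splice]
      · intro i hi
        have : (i : ℕ) < k + 1 := Nat.lt_succ_of_lt hi
        simp [splice, this, bitFlip, hi.ne]
      · simp [splice, bitFlip]
    simp only [hg, ← Finset.mul_sum, ← Finset.sum_mul, prefixAvg]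
    ring
  rw [Finset.sum_congr rfl fun z _ => h z, sum_eq_sum_bitFlip k]
  refine Finset.sum_congr rfl fun z _ => ?_
  have hs : boolSign (bitFlip k z k) = - boolSign (z k) := by
    simp only [bitFlip, if_true, boolSign]
    cases z k <;> simp
  rw [hs, bitFlip_involutive k z, prefixAvg_eq u k, prefixAvg_eq v k, prefixDiff, prefixDiff]
  ring

/-- The discrepancy bound for Greater-Than under its hard distribution. -/
theorem bilinearBound_gtDist [NeZero n] {ε : ℝ} (hε : |ε| ≤ 1) :
    BilinearBound (fun x y => (gtDist n (x, y)).toReal * (boolSign (greaterThan n x y) * ε))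
      (fun x => (∑ y, (gtDist n (x, y)).toReal) / √n)
      (fun y => (∑ x, (gtDist n (x, y)).toReal) / √n) := by
  intro u v
  have hn : 0 < √(n : ℝ) := Real.sqrt_pos.2 (Nat.cast_pos.2 (Nat.pos_of_neZero n))
  have hnn : √(n : ℝ) * √n = n := Real.mul_self_sqrt (Nat.cast_nonneg n)
  have hb : ∀ b, |boolSign b| ≤ 1 := by intro b; cases b <;> simp [boolSign]
  set A := ∑ x, u x ^ 2
  set B := ∑ y, v y ^ 2
  have e1 : ∑ x, (∑ y, (gtDist n (x, y)).toReal) / √n * u x ^ 2 = A / 2 ^ n / √n := by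
    rw [← sum_gtDist_fst, Finset.sum_div]
    refine Finset.sum_congr rfl fun x _ => ?_
    rw [← Finset.sum_mul]
    ring
  have e2 : ∑ y, (∑ x, (gtDist n (x, y)).toReal) / √n * v y ^ 2 = B / 2 ^ n / √n := by
    rw [← sum_gtDist_snd, Finset.sum_comm, Finset.sum_div]
    refine Finset.sum_congr rfl fun x _ => ?_
    rw [← Finset.sum_mul]
    ring
  have e3 : ∑ x, ∑ y, (gtDist n (x, y)).toReal * (boolSign (greaterThan n x y) * ε) *
      (u x * v y) = ∑ x, ∑ y, (gtDist n (x, y)).toReal * (boolSign (greaterThan n x y) *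
        (ε * u x * v y)) :=
    Finset.sum_congr rfl fun x _ => Finset.sum_congr rfl fun y _ => by ring
  rw [e1, e2, e3, sum_gtDist_boolSign, ← add_div, ← add_div]
  -- The factor `ε` is absorbed into `u`, whose norm does not grow.
  have hA : ∑ x, (ε * u x) ^ 2 ≤ A := by
    refine Finset.sum_le_sum fun x _ => ?_
    rw [mul_pow]
    exact mul_le_of_le_one_left (sq_nonneg _) (by rwa [sq_le_one_iff_abs_le_one])
  -- The weights √n and 1/√n in the AM-GM inequality balance the two sums over k: at most `A`, `B`
  -- for squared differences and `n * A`, `n * B` for squared averages.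
  have key : ∀ (k : Fin n) z, boolSign (z k) * (prefixDiff (fun x => ε * u x) k z *
      prefixAvg v k z - prefixAvg (fun x => ε * u x) k z * prefixDiff v k z) ≤
      (√n * prefixDiff (fun x => ε * u x) k z ^ 2 + √n * prefixDiff v k z ^ 2 +
        prefixAvg (fun x => ε * u x) k z ^ 2 / √n + prefixAvg v k z ^ 2 / √n) / 2 := by
    intro k z
    have am : ∀ a b : ℝ, |a * b| ≤ (√n * a ^ 2 + b ^ 2 / √n) / 2 := by
      intro a b
      have h1 : √n * a ^ 2 + b ^ 2 / √n = (√n * |a| - |b|) ^ 2 / √n + 2 * |a * b| := by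
        rw [abs_mul]
        field_simp
        rw [← sq_abs a, ← sq_abs b]
        ring
      have h2 : 0 ≤ (√n * |a| - |b|) ^ 2 / √n := by positivity
      linarith
    set d := prefixDiff (fun x => ε * u x) k z
    set e := prefixDiff v k z
    set a := prefixAvg (fun x => ε * u x) k z
    set b := prefixAvg v k z
    calc boolSign (z k) * (d * b - a * e) ≤ |boolSign (z k)| * |d * b - a * e| := by
          rw [← abs_mul]; exact le_abs_self _
      _ ≤ |d * b - a * e| := mul_le_of_le_one_left (abs_nonneg _) (hb _)
      _ ≤ |d * b| + |a * e| := abs_sub _ _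
      _ ≤ _ := by
        rw [mul_comm a e]
        linarith [am d b, am e a]
  have hsum := Finset.sum_le_sum fun k (_ : k ∈ Finset.univ) =>
    Finset.sum_le_sum fun z (_ : z ∈ Finset.univ) => key k z
  have b1 := sum_prefixDiff_sq_le fun x => ε * u x
  have b2 := sum_prefixDiff_sq_le v
  have b3 : ∑ k : Fin n, ∑ z, prefixAvg (fun x => ε * u x) k z ^ 2 ≤ n * A := by
    refine (Finset.sum_le_sum (s := Finset.univ) (g := fun _ => A)
      fun (k : Fin n) _ => (sum_prefixAvg_sq_le (fun x => ε * u x) (k : ℕ)).trans hA).trans ?_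
    simp
  have b4 : ∑ k : Fin n, ∑ z, prefixAvg v k z ^ 2 ≤ n * B := by
    refine (Finset.sum_le_sum (s := Finset.univ) (g := fun _ => B)
      fun (k : Fin n) _ => sum_prefixAvg_sq_le v (k : ℕ)).trans ?_
    simp
  simp only [← Finset.sum_div, Finset.sum_add_distrib, ← Finset.mul_sum] at hsum
  have hfin : ∑ k : Fin n, ∑ z, boolSign (z k) * (prefixDiff (fun x => ε * u x) k z *
      prefixAvg v k z - prefixAvg (fun x => ε * u x) k z * prefixDiff v k z) ≤
      √n * (A + B) := by
    have c1 := mul_le_mul_of_nonneg_left (b1.trans hA) hn.le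
    have c2 := mul_le_mul_of_nonneg_left b2 hn.le
    have c3 := div_le_div_of_nonneg_right b3 hn.le
    have c4 := div_le_div_of_nonneg_right b4 hn.le
    have c5 : ∀ t : ℝ, n * t / √n = √n * t := by
      intro t
      nth_rewrite 1 [← hnn]
      field_simp
    rw [c5] at c3 c4
    change ∑ k : Fin n, ∑ z, _ ≤ _ at hsum
    linarith
  calc _ ≤ √n * (A + B) / 2 ^ n / n := by gcongr
    _ = (A + B) / 2 ^ n / √n := by
      nth_rewrite 2 [← hnn]
      field_simp

end Bits

theorem HasSum.sum_middle {X T Y : Type*} [Fintype X] [Fintype Y] {F : X × T × Y → ℝ} {c : ℝ}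
    (h : HasSum F c) : HasSum (fun t => ∑ x, ∑ y, F (x, t, y)) c := by
  let e : T × (X × Y) ≃ X × T × Y :=
    { toFun := fun s => (s.2.1, s.1, s.2.2)
      invFun := fun s => (s.2.1, s.1, s.2.2)
      left_inv := fun _ => rfl
      right_inv := fun _ => rfl }
  have h1 : HasSum (F ∘ e) c := e.hasSum_iff.2 h
  have h2 := h1.prod_fiberwise fun t => hasSum_fintype _
  simp only [Fintype.sum_prod_type] at h2
  exact h2

/-! ### Small discrepancy forces large information cost -/

namespace PublicProtocol

open PrivateProtocol

variable {X Y Z : Type*}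

/-- The conditional probability of Alice's bits in `t` given Bob's input, up to the
public randomness and Bob's bits, times `M`. -/
noncomputable def aliceGuess [Fintype X] (μ : PMF (X × Y)) (M : ℝ) (t : Transcript X Y Z) (y : Y) :
    ℝ :=
  M * (∑ x, (μ (x, y)).toReal * (t.1.aliceWeight x t.2).toReal) / ∑ x, (μ (x, y)).toReal

/-- The conditional probability of Bob's bits in `t` given Alice's input, up to the
public randomness and Alice's bits, times `M`. -/
noncomputable def bobGuess [Fintype Y] (μ : PMF (X × Y)) (M : ℝ) (t : Transcript X Y Z) (x : X) :
    ℝ :=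
  M * (∑ y, (μ (x, y)).toReal * (t.1.bobWeight y t.2).toReal) / ∑ y, (μ (x, y)).toReal

theorem aliceJoint_toReal (π : PublicProtocol X Y Z) (μ : PMF (X × Y)) (x : X)
    (t : Transcript X Y Z) (y : Y) :
    (aliceJoint π μ (x, t, y)).toReal = (μ (x, y)).toReal * ((π t.1).toReal *
      ((t.1.aliceWeight x t.2).toReal * (t.1.bobWeight y t.2).toReal)) := by
  rw [aliceJoint_apply, ENNReal.toReal_mul, ENNReal.toReal_mul, ENNReal.toReal_mul]

theorem pmfLast_aliceJoint [Fintype X] (π : PublicProtocol X Y Z) (μ : PMF (X × Y)) (y : Y) :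
    pmfLast (aliceJoint π μ) y = ∑ x, (μ (x, y)).toReal := by
  rw [← sum_pmfFst]
  exact Finset.sum_congr rfl fun x _ => pmfFst_aliceJoint π μ x y

theorem pmfLast_bobJoint [Fintype Y] (π : PublicProtocol X Y Z) (μ : PMF (X × Y)) (x : X) :
    pmfLast (bobJoint π μ) x = ∑ y, (μ (x, y)).toReal := by
  rw [← sum_pmfFst]
  exact Finset.sum_congr rfl fun y _ => pmfFst_bobJoint π μ x y

theorem pmfMid_aliceJoint [Fintype X] (π : PublicProtocol X Y Z) (μ : PMF (X × Y))
    (t : Transcript X Y Z) (y : Y) :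
    pmfMid (aliceJoint π μ) t y = ∑ x, (aliceJoint π μ (x, t, y)).toReal :=
  PMF.map_snd_toReal _ _

theorem pmfMid_bobJoint [Fintype Y] (π : PublicProtocol X Y Z) (μ : PMF (X × Y))
    (t : Transcript X Y Z) (x : X) :
    pmfMid (bobJoint π μ) t x = ∑ y, (aliceJoint π μ (x, t, y)).toReal := by
  simp only [← bobJoint_apply]
  exact PMF.map_snd_toReal _ _

/-- In the likelihood ratio given Bob's input, the public coins and Bob's weight cancel; only
Alice's weight over its conditional mean remains. Positivity of the joint probability permits the
cancellation. -/
theorem aliceWeight_le_guess [Fintype X] (π : PublicProtocol X Y Z) (μ : PMF (X × Y)) {M : ℝ}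
    {x : X} {t : Transcript X Y Z} {y : Y} (h0 : 0 < (aliceJoint π μ (x, t, y)).toReal)
    (h : (aliceJoint π μ (x, t, y)).toReal * pmfLast (aliceJoint π μ) y ≤
      M * (pmfFst (aliceJoint π μ) x y * pmfMid (aliceJoint π μ) t y)) :
    (t.1.aliceWeight x t.2).toReal ≤ aliceGuess μ M t y := by
  rw [pmfLast_aliceJoint, pmfMid_aliceJoint, pmfFst_aliceJoint] at h
  have hs : ∑ x, (aliceJoint π μ (x, t, y)).toReal = (π t.1).toReal *
      (t.1.bobWeight y t.2).toReal *
        ∑ x, (μ (x, y)).toReal * (t.1.aliceWeight x t.2).toReal := by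
    rw [Finset.mul_sum]
    refine Finset.sum_congr rfl fun x _ => ?_
    rw [aliceJoint_toReal]
    ring
  rw [hs] at h
  rw [aliceJoint_toReal] at h h0
  have hm : 0 < (μ (x, y)).toReal := pos_of_mul_pos_left h0 (by positivity)
  have hw : 0 < (π t.1).toReal * (t.1.bobWeight y t.2).toReal := by
    refine lt_of_le_of_ne (by positivity) fun h => h0.ne ?_
    rw [mul_left_comm (π t.1).toReal, ← h]
    ring
  have hS : 0 < ∑ x, (μ (x, y)).toReal :=
    lt_of_lt_of_le hm (Finset.single_le_sum (f := fun x => (μ (x, y)).toReal)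
      (fun _ _ => ENNReal.toReal_nonneg) (Finset.mem_univ x))
  rw [aliceGuess, le_div_iff₀ hS]
  refine le_of_mul_le_mul_left (a := (μ (x, y)).toReal *
    ((π t.1).toReal * (t.1.bobWeight y t.2).toReal)) ?_ (mul_pos hm hw)
  linarith

theorem bobWeight_le_guess [Fintype Y] (π : PublicProtocol X Y Z) (μ : PMF (X × Y)) {M : ℝ}
    {x : X} {t : Transcript X Y Z} {y : Y} (h0 : 0 < (aliceJoint π μ (x, t, y)).toReal)
    (h : (aliceJoint π μ (x, t, y)).toReal * pmfLast (bobJoint π μ) x ≤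
      M * (pmfFst (bobJoint π μ) y x * pmfMid (bobJoint π μ) t x)) :
    (t.1.bobWeight y t.2).toReal ≤ bobGuess μ M t x := by
  rw [pmfLast_bobJoint, pmfMid_bobJoint, pmfFst_bobJoint] at h
  have hs : ∑ y, (aliceJoint π μ (x, t, y)).toReal = (π t.1).toReal *
      (t.1.aliceWeight x t.2).toReal *
        ∑ y, (μ (x, y)).toReal * (t.1.bobWeight y t.2).toReal := by
    rw [Finset.mul_sum]
    refine Finset.sum_congr rfl fun y _ => ?_
    rw [aliceJoint_toReal]
    ring
  rw [hs] at h
  rw [aliceJoint_toReal] at h h0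
  have hm : 0 < (μ (x, y)).toReal := pos_of_mul_pos_left h0 (by positivity)
  have hw : 0 < (π t.1).toReal * (t.1.aliceWeight x t.2).toReal := by
    refine lt_of_le_of_ne (by positivity) fun h => h0.ne ?_
    rw [← mul_assoc (π t.1).toReal, ← h]
    ring
  have hS : 0 < ∑ y, (μ (x, y)).toReal :=
    lt_of_lt_of_le hm (Finset.single_le_sum (f := fun y => (μ (x, y)).toReal)
      (fun _ _ => ENNReal.toReal_nonneg) (Finset.mem_univ y))
  rw [bobGuess, le_div_iff₀ hS]
  refine le_of_mul_le_mul_left (a := (μ (x, y)).toReal *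
    ((π t.1).toReal * (t.1.aliceWeight x t.2).toReal)) ?_ (mul_pos hm hw)
  linarith

theorem aliceGuess_nonneg [Fintype X] (μ : PMF (X × Y)) {M : ℝ} (hM : 0 ≤ M)
    (t : Transcript X Y Z) (y : Y) : 0 ≤ aliceGuess μ M t y := by
  unfold aliceGuess
  positivity

theorem bobGuess_nonneg [Fintype Y] (μ : PMF (X × Y)) {M : ℝ} (hM : 0 ≤ M)
    (t : Transcript X Y Z) (x : X) : 0 ≤ bobGuess μ M t x := by
  unfold bobGuess
  positivity

/-- The joint distribution of inputs and transcript, cut off where the transcript is far more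
likely than the players predict. -/
noncomputable def cutJoint [Fintype X] [Fintype Y] (π : PublicProtocol X Y Z) (μ : PMF (X × Y))
    (M : ℝ) (s : X × Transcript X Y Z × Y) : ℝ :=
  (π s.2.1.1).toReal * ((μ (s.1, s.2.2)).toReal *
    (min (s.2.1.1.aliceWeight s.1 s.2.1.2).toReal (aliceGuess μ M s.2.1 s.2.2) *
      min (bobGuess μ M s.2.1 s.1) (s.2.1.1.bobWeight s.2.2 s.2.1.2).toReal))

theorem cutJoint_nonneg [Fintype X] [Fintype Y] (π : PublicProtocol X Y Z) (μ : PMF (X × Y))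
    {M : ℝ} (hM : 0 ≤ M) (s : X × Transcript X Y Z × Y) : 0 ≤ cutJoint π μ M s :=
  mul_nonneg ENNReal.toReal_nonneg (mul_nonneg ENNReal.toReal_nonneg (mul_nonneg
    (le_min ENNReal.toReal_nonneg (aliceGuess_nonneg μ hM _ _))
    (le_min (bobGuess_nonneg μ hM _ _) ENNReal.toReal_nonneg)))

theorem cutJoint_le [Fintype X] [Fintype Y] (π : PublicProtocol X Y Z) (μ : PMF (X × Y))
    {M : ℝ} (hM : 0 ≤ M) (s : X × Transcript X Y Z × Y) :
    cutJoint π μ M s ≤ (aliceJoint π μ s).toReal := by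
  obtain ⟨x, t, y⟩ := s
  rw [aliceJoint_toReal, mul_left_comm]
  unfold cutJoint
  have := le_min (bobGuess_nonneg μ hM t x)
    (ENNReal.toReal_nonneg (a := t.1.bobWeight y t.2))
  gcongr
  · exact min_le_left _ _
  · exact min_le_right _ _

/-- Outside both tails each minimum equals the true weight, so the cut removes nothing; inside a
tail it removes at most the whole mass. -/
theorem aliceJoint_sub_cutJoint_le [Fintype X] [Fintype Y] (π : PublicProtocol X Y Z)
    (μ : PMF (X × Y)) {M : ℝ} (hM : 0 ≤ M) (x : X) (t : Transcript X Y Z) (y : Y) :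
    (aliceJoint π μ (x, t, y)).toReal - cutJoint π μ M (x, t, y) ≤
      likelihoodTail (aliceJoint π μ) M (x, t, y) +
        likelihoodTail (bobJoint π μ) M (y, t, x) := by
  unfold likelihoodTail
  have hJ := (aliceJoint π μ).toReal_nonneg (x, t, y)
  have hK := cutJoint_nonneg π μ hM (x, t, y)
  rw [bobJoint_apply]
  split_ifs with h1 h2 h2
  · linarith
  · linarith
  · linarith
  · rcases hJ.eq_or_lt with h0 | h0
    · linarith
    · have e1 := aliceWeight_le_guess π μ h0 (not_lt.1 h1)
      have e2 := bobWeight_le_guess π μ h0 (not_lt.1 h2)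
      rw [aliceJoint_toReal]
      unfold cutJoint
      simp only
      rw [min_eq_left e1, min_eq_right e2]
      linarith

/-- The cut-off joint distribution, at a fixed transcript, is an inner product kernel. -/
theorem sum_cutJoint_le [Fintype X] [Fintype Y] (π : PublicProtocol X Y Z) (μ : PMF (X × Y))
    {M δ : ℝ} (hM : 0 ≤ M) {g : X → Y → ℝ}
    (hg : BilinearBound (fun x y => (μ (x, y)).toReal * g x y)
      (fun x => (∑ y, (μ (x, y)).toReal) * δ) (fun y => (∑ x, (μ (x, y)).toReal) * δ))
    (t : Transcript X Y Z) :
    ∑ x, ∑ y, cutJoint π μ M (x, t, y) * g x y ≤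
      2 * M * δ * ∑ x, ∑ y, (aliceJoint π μ (x, t, y)).toReal := by
  -- Each of the two min-kernels multiplies the diagonal by its own arguments; the test vectors are
  -- constantly 1.
  have h := ((hg.mul_min (s := fun x => (t.1.aliceWeight x t.2).toReal)
    (fun x => ENNReal.toReal_nonneg) (aliceGuess_nonneg μ hM t)).mul_min
    (t := fun y => (t.1.bobWeight y t.2).toReal)
    (bobGuess_nonneg μ hM t) (fun y => ENNReal.toReal_nonneg)) 1 1
  simp only [Pi.one_apply, one_pow, mul_one] at h
  -- The denominator of the guess cancels the marginal, so the diagonal reassembles the joint law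
  -- times `M * δ`. If the marginal vanishes, both sides are 0.
  have hx : ∀ x, (∑ y, (μ (x, y)).toReal) * δ * (t.1.aliceWeight x t.2).toReal *
      bobGuess μ M t x = M * δ * ∑ y, (μ (x, y)).toReal * ((t.1.aliceWeight x t.2).toReal *
        (t.1.bobWeight y t.2).toReal) := by
    intro x
    have e : ∑ y, (μ (x, y)).toReal * ((t.1.aliceWeight x t.2).toReal *
        (t.1.bobWeight y t.2).toReal) = (t.1.aliceWeight x t.2).toReal *
          ∑ y, (μ (x, y)).toReal * (t.1.bobWeight y t.2).toReal := by
      rw [Finset.mul_sum]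
      exact Finset.sum_congr rfl fun y _ => by ring
    rw [e, bobGuess]
    by_cases h0 : ∑ y, (μ (x, y)).toReal = 0
    · have h1 : ∀ y, (μ (x, y)).toReal = 0 := fun y =>
        (Finset.sum_eq_zero_iff_of_nonneg fun y _ => ENNReal.toReal_nonneg).1 h0 y
          (Finset.mem_univ y)
      simp [h1]
    · field_simp
  have hy : ∀ y, (∑ x, (μ (x, y)).toReal) * δ * aliceGuess μ M t y *
      (t.1.bobWeight y t.2).toReal = M * δ * ∑ x, (μ (x, y)).toReal *
        ((t.1.aliceWeight x t.2).toReal * (t.1.bobWeight y t.2).toReal) := by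
    intro y
    have e : ∑ x, (μ (x, y)).toReal * ((t.1.aliceWeight x t.2).toReal *
        (t.1.bobWeight y t.2).toReal) = (t.1.bobWeight y t.2).toReal *
          ∑ x, (μ (x, y)).toReal * (t.1.aliceWeight x t.2).toReal := by
      rw [Finset.mul_sum]
      exact Finset.sum_congr rfl fun y _ => by ring
    rw [e, aliceGuess]
    by_cases h0 : ∑ x, (μ (x, y)).toReal = 0
    · have h1 : ∀ x, (μ (x, y)).toReal = 0 := fun x =>
        (Finset.sum_eq_zero_iff_of_nonneg fun y _ => ENNReal.toReal_nonneg).1 h0 x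
          (Finset.mem_univ x)
      simp [h1]
    · field_simp
  rw [Finset.sum_congr rfl fun x _ => hx x, Finset.sum_congr rfl fun y _ => hy y,
    ← Finset.mul_sum, ← Finset.mul_sum,
    Finset.sum_comm (f := fun y x => (μ (x, y)).toReal * ((t.1.aliceWeight x t.2).toReal *
        (t.1.bobWeight y t.2).toReal))] at h
  have e1 : ∑ x, ∑ y, cutJoint π μ M (x, t, y) * g x y = (π t.1).toReal *
      ∑ x, ∑ y, (μ (x, y)).toReal * g x y * min (t.1.aliceWeight x t.2).toReal
        (aliceGuess μ M t y) * min (bobGuess μ M t x) (t.1.bobWeight y t.2).toReal := by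
    simp only [Finset.mul_sum]
    refine Finset.sum_congr rfl fun x _ => Finset.sum_congr rfl fun y _ => ?_
    unfold cutJoint
    ring
  have e2 : ∑ x, ∑ y, (aliceJoint π μ (x, t, y)).toReal = (π t.1).toReal *
      ∑ x, ∑ y, (μ (x, y)).toReal * ((t.1.aliceWeight x t.2).toReal *
        (t.1.bobWeight y t.2).toReal) := by
    simp only [Finset.mul_sum, aliceJoint_toReal]
    exact Finset.sum_congr rfl fun x _ => Finset.sum_congr rfl fun y _ => by ring
  rw [e1, e2]
  have := mul_le_mul_of_nonneg_left h ((π).toReal_nonneg t.1)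
  linarith

theorem boolSign_mul_boolSign (a b : Bool) :
    boolSign a * boolSign b = 1 - 2 * (if b ≠ a then 1 else 0) := by
  cases a <;> cases b <;> norm_num [boolSign]

theorem hasSum_errorProb (π : PublicProtocol X Y Bool) (f : X → Y → Bool) (μ : PMF (X × Y)) :
    HasSum (fun s : X × Transcript X Y Bool × Y => (aliceJoint π μ s).toReal *
      if s.2.1.1.output s.2.1.2 ≠ f s.1 s.2.2 then 1 else 0) (π.errorProb f μ) := by
  have h : π.errorProb f μ = ∑' s : X × Transcript X Y Bool × Y, (aliceJoint π μ s).toReal *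
      if s.2.1.1.output s.2.1.2 ≠ f s.1 s.2.2 then 1 else 0 := by
    rw [errorProb_eq]
    exact tsum_congr fun s => by rw [mul_ite, mul_one, mul_zero]
  rw [h]
  refine Summable.hasSum (Summable.of_nonneg_of_le (fun s => ?_) (fun s => ?_)
    (aliceJoint π μ).hasSum_toReal.summable)
  · exact mul_nonneg ENNReal.toReal_nonneg (by split_ifs <;> norm_num)
  · exact mul_le_of_le_one_right ENNReal.toReal_nonneg (by split_ifs <;> norm_num)

theorem hasSum_boolSign_mul_boolSign (π : PublicProtocol X Y Bool) (f : X → Y → Bool)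
    (μ : PMF (X × Y)) :
    HasSum (fun s : X × Transcript X Y Bool × Y => (aliceJoint π μ s).toReal *
      (boolSign (f s.1 s.2.2) * boolSign (s.2.1.1.output s.2.1.2)))
      (1 - 2 * π.errorProb f μ) := by
  have h := (aliceJoint π μ).hasSum_toReal.sub ((hasSum_errorProb π f μ).mul_left 2)
  refine h.congr_fun fun s => ?_
  rw [boolSign_mul_boolSign]
  ring

theorem summable_cutJoint_mul [Fintype X] [Fintype Y] (π : PublicProtocol X Y Z)
    (μ : PMF (X × Y)) {M : ℝ} (hM : 0 ≤ M) {g : X × Transcript X Y Z × Y → ℝ}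
    (hg : ∀ s, |g s| ≤ 1) : Summable fun s => cutJoint π μ M s * g s := by
  refine Summable.of_norm_bounded (aliceJoint π μ).hasSum_toReal.summable fun s => ?_
  rw [Real.norm_eq_abs, abs_mul, abs_of_nonneg (cutJoint_nonneg π μ hM s)]
  exact (mul_le_of_le_one_right (cutJoint_nonneg π μ hM s) (hg s)).trans (cutJoint_le π μ hM s)

theorem tsum_cutJoint_mul_le [Fintype X] [Fintype Y] (π : PublicProtocol X Y Z)
    (μ : PMF (X × Y)) {M δ : ℝ} (hM : 0 ≤ M) {g : X × Transcript X Y Z × Y → ℝ}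
    (hg : ∀ s, |g s| ≤ 1)
    (hf : ∀ t, BilinearBound (fun x y => (μ (x, y)).toReal * g (x, t, y))
      (fun x => (∑ y, (μ (x, y)).toReal) * δ) (fun y => (∑ x, (μ (x, y)).toReal) * δ)) :
    ∑' s, cutJoint π μ M s * g s ≤ 2 * M * δ := by
  have h1 := (summable_cutJoint_mul π μ hM hg).hasSum.sum_middle
  have h2 := (aliceJoint π μ).hasSum_toReal.sum_middle.mul_left (2 * M * δ)
  rw [mul_one] at h2
  exact hasSum_le (fun t => sum_cutJoint_le π μ hM (hf t) t) h1 h2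

theorem tsum_sub_cutJoint_mul_le [Fintype X] [Fintype Y] (π : PublicProtocol X Y Z)
    (μ : PMF (X × Y)) {M c : ℝ} (hM : 0 ≤ M) {g : X × Transcript X Y Z × Y → ℝ}
    (hg : ∀ s, |g s| ≤ 1) (hc : HasSum (fun s => (aliceJoint π μ s).toReal * g s) c) :
    c - ∑' s, cutJoint π μ M s * g s ≤
      ∑' s, likelihoodTail (aliceJoint π μ) M s + ∑' s, likelihoodTail (bobJoint π μ) M s := by
  let e : X × Transcript X Y Z × Y ≃ Y × Transcript X Y Z × X :=
    { toFun := fun s => (s.2.2, s.2.1, s.1)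
      invFun := fun s => (s.2.2, s.2.1, s.1)
      left_inv := fun _ => rfl
      right_inv := fun _ => rfl }
  have h2 := e.hasSum_iff.2 (summable_likelihoodTail (bobJoint π μ) M).hasSum
  refine hasSum_le (fun s => ?_) (hc.sub (summable_cutJoint_mul π μ hM hg).hasSum)
    ((summable_likelihoodTail (aliceJoint π μ) M).hasSum.add h2)
  rw [← sub_mul]
  exact (mul_le_of_le_one_right (sub_nonneg.2 (cutJoint_le π μ hM s))
    ((le_abs_self _).trans (hg s))).trans (aliceJoint_sub_cutJoint_le π μ hM s.1 s.2.1 s.2.2)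

/-- Small discrepancy forces large information cost. -/
theorem logb_mul_le_infoCost [Fintype X] [Fintype Y] (π : PublicProtocol X Y Bool)
    (f : X → Y → Bool) (μ : PMF (X × Y)) {M δ : ℝ} (hM : 1 ≤ M)
    (hf : ∀ ε : ℝ, |ε| ≤ 1 →
      BilinearBound (fun x y => (μ (x, y)).toReal * (boolSign (f x y) * ε))
        (fun x => (∑ y, (μ (x, y)).toReal) * δ) (fun y => (∑ x, (μ (x, y)).toReal) * δ)) :
    Real.logb 2 M * (1 - 2 * π.errorProb f μ - 2 * M * δ) ≤
      π.infoCost μ + 2 / Real.log 2 := by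
  have hM0 : 0 ≤ M := zero_le_one.trans hM
  have hb : ∀ b, |boolSign b| ≤ 1 := by intro b; cases b <;> simp [boolSign]
  have hg : ∀ s : X × Transcript X Y Bool × Y,
      |boolSign (f s.1 s.2.2) * boolSign (s.2.1.1.output s.2.1.2)| ≤ 1 := fun s => by
    rw [abs_mul]
    exact mul_le_one₀ (hb _) (abs_nonneg _) (hb _)
  have h1 := logb_mul_tail_le_condMutualInfo (aliceJoint π μ) hM
  have h2 := logb_mul_tail_le_condMutualInfo (bobJoint π μ) hM
  have h3 := tsum_cutJoint_mul_le π μ hM0 hg fun t => hf _ (hb (t.1.output t.2))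
  have h4 := tsum_sub_cutJoint_mul_le π μ hM0 hg (hasSum_boolSign_mul_boolSign π f μ)
  have hlog : 0 ≤ Real.logb 2 M := Real.logb_nonneg one_lt_two hM
  -- The full correlation is 1 - 2·error; the cut part contributes at most 2Mδ, and the removed part
  -- at most the tails.
  have h5 : 1 - 2 * π.errorProb f μ - 2 * M * δ ≤
      ∑' s, likelihoodTail (aliceJoint π μ) M s + ∑' s, likelihoodTail (bobJoint π μ) M s := by
    linarith
  refine (mul_le_mul_of_nonneg_left h5 hlog).trans ?_
  rw [infoCost_eq, mul_add]
  have e2 : 2 / Real.log 2 = 1 / Real.log 2 + 1 / Real.log 2 := by ring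
  linarith

/-- The tail bound at M = 1. This crude estimate suffices to make the infimum over protocols one of
a set bounded below. -/
theorem neg_le_infoCost [Fintype X] [Fintype Y] (π : PublicProtocol X Y Z) (μ : PMF (X × Y)) :
    -(2 / Real.log 2) ≤ π.infoCost μ := by
  have h1 := logb_mul_tail_le_condMutualInfo (aliceJoint π μ) le_rfl
  have h2 := logb_mul_tail_le_condMutualInfo (bobJoint π μ) le_rfl
  rw [Real.logb_one, zero_mul] at h1 h2
  rw [infoCost_eq]
  have e2 : 2 / Real.log 2 = 1 / Real.log 2 + 1 / Real.log 2 := by ring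
  linarith

end PublicProtocol

/-! ### The lower bound for Greater-Than -/

theorem logb_le_infoCost_gtDist {n : ℕ} [NeZero n] (hn : 2 ^ 60 ≤ n)
    (π : PublicProtocol (Fin n → Bool) (Fin n → Bool) Bool)
    (hπ : π.errorProb (greaterThan n) (gtDist n) ≤ 1 / 10) :
    1 / 10 * Real.logb 2 n ≤ π.infoCost (gtDist n) := by
  have hn' : (2 : ℝ) ^ 60 ≤ n := by exact_mod_cast hn
  have hn0 : (0 : ℝ) < n := lt_of_lt_of_le (by positivity) hn'
  have hL : 60 ≤ Real.logb 2 n := by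
    rw [Real.le_logb_iff_rpow_le one_lt_two hn0]
    exact_mod_cast hn
  have hs : (2 : ℝ) ^ 30 ≤ √n := Real.le_sqrt_of_sq_le (by rw [← pow_mul]; exact hn')
  have hs2 : (2 : ℝ) ^ 15 ≤ √√n := Real.le_sqrt_of_sq_le (by rw [← pow_mul]; exact hs)
  have hlog : Real.logb 2 √√n = Real.logb 2 n / 4 := by
    rw [Real.logb, Real.logb, Real.log_sqrt (Real.sqrt_nonneg _), Real.log_sqrt hn0.le]
    ring
  have hM : 1 ≤ √√(n : ℝ) := le_trans (by norm_num) hs2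
  -- With M = n^(1/4), both log M is of order log n and 2Mδ = 2n^(-1/4) is small. The result is
  -- (7/40) log₂ n - 3, which exceeds (1/10) log₂ n once log₂ n ≥ 40.
  have key := π.logb_mul_le_infoCost (greaterThan n) (gtDist n) (M := √√n) (δ := (√n)⁻¹) hM
    (fun ε hε => by simpa only [div_eq_mul_inv] using bilinearBound_gtDist hε)
  have hδ : 2 * √√(n : ℝ) * (√n)⁻¹ ≤ 1 / 10 := by
    have e : √√(n : ℝ) * √√n = √n := Real.mul_self_sqrt (Real.sqrt_nonneg _)
    have : 2 * √√(n : ℝ) * (√n)⁻¹ = 2 / √√(n : ℝ) := by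
      have : √√(n : ℝ) ≠ 0 := by linarith
      have h : √(n : ℝ) ≠ 0 := by linarith
      field_simp
      linarith
    rw [this, div_le_div_iff₀ (by linarith) (by norm_num)]
    linarith
  have hl2 : 2 / Real.log 2 ≤ 3 := by
    have := Real.log_two_gt_d9
    rw [div_le_iff₀ (by linarith)]
    linarith
  rw [hlog] at key
  have h7 : Real.logb 2 n / 4 * (7 / 10) ≤ Real.logb 2 n / 4 *
      (1 - 2 * π.errorProb (greaterThan n) (gtDist n) - 2 * √√n * (√n)⁻¹) :=
    mul_le_mul_of_nonneg_left (by linarith) (by linarith)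
  linarith

/-! ### Failure probability and length of protocols -/

section Failure

variable {X Y Z : Type*}

/-- The probability that the output of `r` on `x`, `y` is not `v`. -/
noncomputable def PrivateProtocol.failure (x : X) (y : Y) (v : Z) (r : PrivateProtocol X Y Z) :
    ℝ≥0∞ :=
  (r.run x y).toOuterMeasure {s | s.2 ≠ v}

/-- The probability that the output of `π` on `x`, `y` is not `v`. -/
noncomputable def PublicProtocol.failure (x : X) (y : Y) (v : Z) (π : PublicProtocol X Y Z) :
    ℝ≥0∞ :=
  ∑' r, π r * r.failure x y v

theorem PMF.toOuterMeasure_le_one {α : Type*} (p : PMF α) (s : Set α) :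
    p.toOuterMeasure s ≤ 1 := by
  rw [PMF.toOuterMeasure_apply, ← p.tsum_coe]
  exact ENNReal.tsum_le_tsum fun a => Set.indicator_le_self _ _ a

theorem PrivateProtocol.failure_le_one (x : X) (y : Y) (v : Z) (r : PrivateProtocol X Y Z) :
    r.failure x y v ≤ 1 :=
  PMF.toOuterMeasure_le_one _ _

theorem PMF.tsum_mul_le_one {α : Type*} (p : PMF α) {f : α → ℝ≥0∞} (hf : ∀ a, f a ≤ 1) :
    ∑' a, p a * f a ≤ 1 := by
  rw [← p.tsum_coe]
  exact ENNReal.tsum_le_tsum fun a => mul_le_of_le_one_right' (hf a)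

theorem PMF.tsum_pure_mul {α : Type*} (a : α) (f : α → ℝ≥0∞) :
    ∑' b, PMF.pure a b * f b = f a := by
  rw [tsum_eq_single a]
  · simp
  · intro b hb
    simp [PMF.pure_apply, hb]

theorem PMF.tsum_bind_mul {α β : Type*} (p : PMF α) (g : α → PMF β) (f : β → ℝ≥0∞) :
    ∑' b, p.bind g b * f b = ∑' a, p a * ∑' b, g a b * f b := by
  simp only [PMF.bind_apply, ← ENNReal.tsum_mul_right, ← ENNReal.tsum_mul_left]
  rw [ENNReal.tsum_comm]
  simp only [mul_assoc]

theorem PMF.tsum_mul_const {α : Type*} (p : PMF α) (c : ℝ≥0∞) : ∑' a, p a * c = c := by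
  rw [ENNReal.tsum_mul_right, p.tsum_coe, one_mul]

namespace PublicProtocol

theorem failure_le_one (x : X) (y : Y) (v : Z) (π : PublicProtocol X Y Z) :
    π.failure x y v ≤ 1 :=
  PMF.tsum_mul_le_one _ fun r => r.failure_le_one x y v

theorem errorAt_eq (π : PublicProtocol X Y Z) (f : X → Y → Z) (x : X) (y : Y) :
    π.errorAt f x y = (π.failure x y (f x y)).toReal := by
  unfold errorAt run failure PrivateProtocol.failure
  rw [PMF.toOuterMeasure_bind_apply]
  simp only [PMF.toOuterMeasure_map_apply]
  rfl

theorem errorProb_le {π : PublicProtocol X Y Z} {f : X → Y → Z} {ρ : ℝ}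
    (h : ∀ x y, π.errorAt f x y ≤ ρ) (μ : PMF (X × Y)) : π.errorProb f μ ≤ ρ := by
  obtain ⟨p, -⟩ := μ.support_nonempty
  have hρ : 0 ≤ ρ := ENNReal.toReal_nonneg.trans (h p.1 p.2)
  refine ENNReal.toReal_le_of_le_ofReal hρ ?_
  rw [joint, PMF.toOuterMeasure_bind_apply]
  simp only [PMF.toOuterMeasure_map_apply]
  calc _ ≤ ∑' p, μ p * ENNReal.ofReal ρ := by
        refine ENNReal.tsum_le_tsum fun p => ?_
        gcongr
        rw [ENNReal.le_ofReal_iff_toReal_le _ hρ]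
        · exact h p.1 p.2
        · exact ne_top_of_le_ne_top ENNReal.one_ne_top (PMF.toOuterMeasure_le_one _ _)
    _ = _ := PMF.tsum_mul_const _ _

end PublicProtocol

/-- At most `m` bits are sent in any run of `r`. -/
def PrivateProtocol.LengthLE (m : ℕ) (r : PrivateProtocol X Y Z) : Prop :=
  ∀ x y, ∀ s ∈ (r.run x y).support, s.1.length ≤ m

/-- At most `m` bits are sent in any run of `π`. -/
def PublicProtocol.LengthLE (m : ℕ) (π : PublicProtocol X Y Z) : Prop :=
  ∀ r ∈ π.support, r.LengthLE m

theorem PrivateProtocol.LengthLE.mono {m m' : ℕ} (h : m ≤ m') {r : PrivateProtocol X Y Z}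
    (hr : r.LengthLE m) : r.LengthLE m' :=
  fun x y s hs => (hr x y s hs).trans h

theorem PublicProtocol.LengthLE.mono {m m' : ℕ} (h : m ≤ m') {π : PublicProtocol X Y Z}
    (hr : π.LengthLE m) : π.LengthLE m' :=
  fun r hs => (hr r hs).mono h

theorem PrivateProtocol.LengthLE.alice {m : ℕ} (send : X → PMF Bool)
    {child : Bool → PrivateProtocol X Y Z} (h : ∀ b, (child b).LengthLE m) :
    (PrivateProtocol.alice send child).LengthLE (m + 1) := by
  intro x y s hs
  simp only [run, PMF.mem_support_bind_iff, PMF.mem_support_map_iff] at hs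
  obtain ⟨b, -, s', hs', rfl⟩ := hs
  exact Nat.succ_le_succ (h b x y s' hs')

theorem PrivateProtocol.LengthLE.bob {m : ℕ} (send : Y → PMF Bool)
    {child : Bool → PrivateProtocol X Y Z} (h : ∀ b, (child b).LengthLE m) :
    (PrivateProtocol.bob send child).LengthLE (m + 1) := by
  intro x y s hs
  simp only [run, PMF.mem_support_bind_iff, PMF.mem_support_map_iff] at hs
  obtain ⟨b, -, s', hs', rfl⟩ := hs
  exact Nat.succ_le_succ (h b x y s' hs')

theorem PrivateProtocol.LengthLE.leaf (z : Z) :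
    (PrivateProtocol.leaf z : PrivateProtocol X Y Z).LengthLE 0 := by
  intro x y s hs
  simp_all [run]

theorem PublicProtocol.commCost_le {m : ℕ} {π : PublicProtocol X Y Z} (h : π.LengthLE m) :
    π.commCost ≤ m := by
  refine iSup_le fun x => iSup_le fun y => iSup_le fun s => iSup_le fun hs => ?_
  simp only [run, PMF.mem_support_bind_iff, PMF.mem_support_map_iff] at hs
  obtain ⟨r, hr, s', hs', rfl⟩ := hs
  exact_mod_cast h r hr x y s' hs'

end Failure

/-! ### Randomized equality test -/

section HashTest

variable {X Y Z W : Type*}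

/-- Alice sends the hash of her word, Bob tells whether his word has the same hash, and the players
go on with `same` or `diff` accordingly. -/
noncomputable def compareHash (a : X → W) (b : Y → W) (h : W → Bool)
    (same diff : PrivateProtocol X Y Z) : PrivateProtocol X Y Z :=
  .alice (fun x => PMF.pure (h (a x))) fun c =>
    .bob (fun y => PMF.pure (decide (h (b y) = c))) fun e => if e then same else diff

theorem failure_compareHash (a : X → W) (b : Y → W) (h : W → Bool)
    (same diff : PrivateProtocol X Y Z) (x : X) (y : Y) (v : Z) :
    (compareHash a b h same diff).failure x y v =
      if h (b y) = h (a x) then same.failure x y v else diff.failure x y v := by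
  unfold compareHash PrivateProtocol.failure
  simp only [PrivateProtocol.run, PMF.pure_bind, PMF.toOuterMeasure_map_apply]
  by_cases hab : h (b y) = h (a x)
  · have hd : decide (h (b y) = h (a x)) = true := decide_eq_true hab
    rw [if_pos hab]
    simp only [hd, if_true]
    rfl
  · have hd : decide (h (b y) = h (a x)) = false := decide_eq_false hab
    rw [if_neg hab]
    simp only [hd, Bool.false_eq_true, if_false]
    rfl

theorem lengthLE_compareHash (a : X → W) (b : Y → W) (h : W → Bool)
    {same diff : PrivateProtocol X Y Z} {m : ℕ} (hs : same.LengthLE m) (hd : diff.LengthLE m) :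
    (compareHash a b h same diff).LengthLE (m + 2) := by
  refine .alice _ fun c => .bob _ fun e => ?_
  cases e
  · exact hd
  · exact hs

variable [Fintype W] [DecidableEq W]

/-- The players compare `j` random hash bits of their words, and go on with `diff` once these
differ, and with `same` if they all agree. -/
noncomputable def hashTest (a : X → W) (b : Y → W) (same diff : PublicProtocol X Y Z) :
    ℕ → PublicProtocol X Y Z
  | 0 => same
  | j + 1 => (PMF.uniformOfFintype (W → Bool)).bind fun h =>
      (hashTest a b same diff j).bind fun r => diff.bind fun r' => PMF.pure (compareHash a b h r r')

theorem lengthLE_hashTest (a : X → W) (b : Y → W) {same diff : PublicProtocol X Y Z} {m : ℕ}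
    (hs : same.LengthLE m) (hd : diff.LengthLE m) (j : ℕ) :
    (hashTest a b same diff j).LengthLE (m + 2 * j) := by
  induction j with
  | zero => exact hs
  | succ j ih =>
    intro r hr
    simp only [hashTest, PMF.mem_support_bind_iff, PMF.mem_support_pure_iff] at hr
    obtain ⟨h, -, r, hr, r', hr', rfl⟩ := hr
    exact lengthLE_compareHash a b h (ih r hr) ((hd r' hr').mono (Nat.le_add_right _ _))

theorem failure_hashTest_succ (a : X → W) (b : Y → W) (same diff : PublicProtocol X Y Z) (j : ℕ)
    (x : X) (y : Y) (v : Z) :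
    (hashTest a b same diff (j + 1)).failure x y v =
      ∑ h : W → Bool, PMF.uniformOfFintype (W → Bool) h *
        if h (b y) = h (a x) then (hashTest a b same diff j).failure x y v
        else diff.failure x y v := by
  rw [PublicProtocol.failure, hashTest, PMF.tsum_bind_mul, tsum_fintype]
  refine Finset.sum_congr rfl fun h _ => ?_
  congr 1
  rw [PMF.tsum_bind_mul]
  simp only [PMF.tsum_bind_mul, PMF.tsum_pure_mul, failure_compareHash]
  split_ifs
  · simp only [PMF.tsum_mul_const]
    rfl
  · exact PMF.tsum_mul_const _ _

theorem failure_hashTest_of_eq {a : X → W} {b : Y → W} {x : X} {y : Y} (h : a x = b y)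
    (same diff : PublicProtocol X Y Z) (j : ℕ) (v : Z) :
    (hashTest a b same diff j).failure x y v = same.failure x y v := by
  induction j with
  | zero => rfl
  | succ j ih =>
    rw [failure_hashTest_succ]
    simp only [h, if_true]
    rw [← tsum_fintype (L := .unconditional _), PMF.tsum_mul_const, ih]

/-- Flipping the value of `g` at `u` preserves the uniform law and exchanges collision with
non-collision. -/
theorem two_mul_sum_uniform_ite {u w : W} (h : u ≠ w) (A B : ℝ≥0∞) :
    2 * ∑ g : W → Bool, PMF.uniformOfFintype (W → Bool) g * (if g u = g w then A else B) =
      A + B := by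
  let e : (W → Bool) → (W → Bool) := fun g i => if i = u then !g i else g i
  have he : Function.Involutive e := by
    intro g
    funext i
    by_cases hi : i = u <;> simp [e, hi]
  have h1 : ∑ g : W → Bool, PMF.uniformOfFintype (W → Bool) g * (if g u = g w then A else B) =
      ∑ g : W → Bool, PMF.uniformOfFintype (W → Bool) g * (if g u = g w then B else A) := by
    rw [← Equiv.sum_comp (Function.Involutive.toPerm e he)]
    refine Finset.sum_congr rfl fun g _ => ?_
    have e1 : Function.Involutive.toPerm e he g u = (!g u) := if_pos rfl
    have e2 : Function.Involutive.toPerm e he g w = g w := if_neg h.symm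
    rw [e1, e2, PMF.uniformOfFintype_apply, PMF.uniformOfFintype_apply]
    cases g u <;> cases g w <;> simp
  rw [two_mul]
  nth_rewrite 2 [h1]
  rw [← Finset.sum_add_distrib, ← PMF.tsum_mul_const (PMF.uniformOfFintype (W → Bool)) (A + B),
    tsum_fintype]
  refine Finset.sum_congr rfl fun g _ => ?_
  rw [← mul_add]
  split_ifs
  · rfl
  · rw [add_comm]

/-- Different words survive all `j` comparisons with probability `2 ^ (-j)`. The error is one-sided:
equal words are never declared different. -/
theorem failure_hashTest_le {a : X → W} {b : Y → W} {x : X} {y : Y} (h : a x ≠ b y)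
    (same diff : PublicProtocol X Y Z) (j : ℕ) (v : Z) :
    2 ^ j * (hashTest a b same diff j).failure x y v ≤
      2 ^ j * diff.failure x y v + same.failure x y v := by
  induction j with
  | zero => simp [hashTest]
  | succ j ih =>
    rw [failure_hashTest_succ, pow_succ, mul_assoc, two_mul_sum_uniform_ite h.symm, mul_add]
    calc _ ≤ 2 ^ j * diff.failure x y v + same.failure x y v + 2 ^ j * diff.failure x y v := by
          gcongr
      _ = _ := by ring

end HashTest

/-! ### Noisy binary search with backtracking -/

section Search

variable {n : ℕ}

/-- The first `p` bits of a word. -/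
def maskWord (p : ℕ) (w : Fin n → Bool) : Fin n → Bool := fun i => decide ((i : ℕ) < p) && w i

theorem maskWord_eq_iff {w w' : Fin n → Bool} {L : Fin n} (h : ∀ i < L, w i = w' i)
    (hL : w L ≠ w' L) (p : ℕ) : maskWord p w = maskWord p w' ↔ p ≤ L := by
  constructor
  · intro e
    by_contra! hp
    have := congrFun e L
    simp only [maskWord, hp, decide_true, Bool.true_and] at this
    exact hL this
  · intro hp
    funext i
    by_cases hi : (i : ℕ) < p
    · simp [maskWord, h i (Fin.lt_def.2 (hi.trans_le hp))]
    · simp [maskWord, hi]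

/-- Alice's input with an end marker. -/
def aliceWord (x : Fin n → Bool) : Fin (n + 1) → Bool := Fin.snoc (α := fun _ => Bool) x false

/-- Bob's input with an end marker. -/
def bobWord (y : Fin n → Bool) : Fin (n + 1) → Bool := Fin.snoc (α := fun _ => Bool) y true

theorem exists_first_difference (x y : Fin n → Bool) : ∃ L : Fin (n + 1),
    (∀ i < L, aliceWord x i = bobWord y i) ∧ aliceWord x L ≠ bobWord y L := by
  have h : ∃ L, aliceWord x L ≠ bobWord y L := ⟨Fin.last n, by simp [aliceWord, bobWord]⟩
  classical
  refine ⟨Fin.find _ h, fun i hi => ?_, Fin.find_spec h⟩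
  exact not_not.1 (Fin.find_min h hi)

/-- The end markers make the words differ even if x = y; the first difference is then the marker,
and Alice's marker `false` is the correct answer. -/
theorem greaterThan_eq_aliceWord {x y : Fin n → Bool} {L : Fin (n + 1)}
    (h : ∀ i < L, aliceWord x i = bobWord y i) (hL : aliceWord x L ≠ bobWord y L) :
    greaterThan n x y = aliceWord x L := by
  have hc : ∀ i : Fin n, i.castSucc < L → x i = y i := fun i hi => by
    simpa [aliceWord, bobWord] using h i.castSucc hi
  induction L using Fin.lastCases with
  | last =>
    have : x = y := funext fun i => hc i (Fin.castSucc_lt_last i)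
    simp [this, greaterThan, aliceWord]
  | cast k =>
    rw [greaterThan_eq k (fun i hi => hc i (Fin.castSucc_lt_castSucc_iff.2 hi))]
    · simp [aliceWord]
    · simpa [aliceWord, bobWord] using hL

/-- A stack of nested intervals, the innermost one first, in a search among `2 ^ D` positions. -/
abbrev SearchStack := List (ℕ × ℕ)

namespace SearchStack

/-- The innermost interval. -/
def top (D : ℕ) (s : SearchStack) : ℕ × ℕ := s.headD (0, 2 ^ D)

/-- The least right end of an interval. -/
def minRight (D : ℕ) : SearchStack → ℕ
  | [] => 2 ^ D
  | e :: s => min e.2 (minRight D s)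

/-- All intervals end after `L`, and their lengths are halved from one to the next. -/
def Valid (D L : ℕ) : SearchStack → Prop
  | [] => True
  | e :: s => L < e.2 ∧ e.2 ≤ e.1 + 2 ^ (D - (s.length + 1)) ∧ Valid D L s

/-- The intervals starting after `L` count against those that contain `L`. -/
noncomputable def potential (L : ℕ) : SearchStack → ℝ
  | [] => 1
  | e :: s => (if e.1 ≤ L then 1 / 2 else 2) * potential L s

theorem potential_pos (L : ℕ) (s : SearchStack) : 0 < potential L s := by
  induction s with
  | nil => exact one_pos
  | cons e s ih =>
    rw [potential]
    split_ifs <;> positivity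

theorem one_le_pow_mul_potential (L : ℕ) (s : SearchStack) :
    1 ≤ 2 ^ s.length * potential L s := by
  induction s with
  | nil => simp [potential]
  | cons e s ih =>
    rw [potential, List.length_cons, pow_succ]
    split_ifs <;> linarith

theorem Valid.lt_minRight {D L : ℕ} (hL : L < 2 ^ D) {s : SearchStack} (h : Valid D L s) :
    L < minRight D s := by
  induction s with
  | nil => exact hL
  | cons e s ih => exact lt_min h.1 (ih h.2.2)

/-- An interval containing `L` at depth at least `D` has length one, so it ends at `L + 1`, the
least possible right end. If no such interval exists, at most `D` halvings of the potential are
uncompensated: an interval missing `L` only doubles it. -/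
theorem Valid.potential_or {D L : ℕ} (hL : L < 2 ^ D) {s : SearchStack} (h : Valid D L s) :
    1 ≤ 2 ^ D * potential L s ∨ minRight D s = L + 1 := by
  induction s with
  | nil => left; simpa [potential] using one_le_pow₀ (one_le_two (α := ℝ))
  | cons e s ih =>
    have h1 := h.2.2.lt_minRight hL
    obtain ⟨h2, h3, h4⟩ := h
    by_cases he : e.1 ≤ L
    · by_cases hD : D ≤ s.length + 1
      · right
        rw [Nat.sub_eq_zero_of_le hD, pow_zero] at h3
        rw [minRight]
        omega
      · left
        refine (one_le_pow_mul_potential L (e :: s)).trans ?_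
        refine mul_le_mul_of_nonneg_right ?_ (potential_pos _ _).le
        exact pow_le_pow_right₀ one_le_two (by rw [List.length_cons]; omega)
    · rcases ih h4 with h | h
      · left
        rw [potential, if_neg he]
        linarith
      · right
        rw [minRight, h]
        omega

theorem Valid.top_spec {D L : ℕ} (hL : L < 2 ^ D) {s : SearchStack} (h : Valid D L s) :
    L < (top D s).2 ∧ (top D s).2 ≤ (top D s).1 + 2 ^ (D - s.length) := by
  cases s with
  | nil => simpa [top] using hL
  | cons e s => exact ⟨h.1, h.2.1⟩

/-- Going right needs no condition on the midpoint, since validity concerns right ends only. A false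
"equal" thus spoils left ends alone, and going left follows a "different", which is always true. -/
theorem Valid.push_right {D L : ℕ} (hL : L < 2 ^ D) {s : SearchStack} (h : Valid D L s) :
    Valid D L ((((top D s).1 + (top D s).2) / 2, (top D s).2) :: s) := by
  obtain ⟨h1, h2⟩ := h.top_spec hL
  refine ⟨h1, ?_, h⟩
  simp only
  rcases le_or_gt D s.length with hD | hD
  · rw [Nat.sub_eq_zero_of_le hD] at h2
    rw [Nat.sub_eq_zero_of_le (by omega)]
    omega
  · have : D - s.length = (D - (s.length + 1)) + 1 := by omega
    rw [this, pow_succ] at h2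
    omega

theorem Valid.push_left {D L : ℕ} (hL : L < 2 ^ D) {s : SearchStack} (h : Valid D L s)
    (hm : L < ((top D s).1 + (top D s).2) / 2) :
    Valid D L (((top D s).1, ((top D s).1 + (top D s).2) / 2) :: s) := by
  obtain ⟨h1, h2⟩ := h.top_spec hL
  refine ⟨hm, ?_, h⟩
  simp only
  rcases le_or_gt D s.length with hD | hD
  · rw [Nat.sub_eq_zero_of_le hD] at h2
    rw [Nat.sub_eq_zero_of_le (by omega)]
    omega
  · have : D - s.length = (D - (s.length + 1)) + 1 := by omega
    rw [this, pow_succ] at h2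
    omega

end SearchStack

/-- Alice announces the bit of her word at position `p`. -/
noncomputable def announceBit (p : ℕ) : PrivateProtocol (Fin n → Bool) (Fin n → Bool) Bool :=
  .alice (fun x => PMF.pure (if h : p < n + 1 then aliceWord x ⟨p, h⟩ else false)) fun b => .leaf b

/-- Test whether the first `p` bits of the words agree. -/
noncomputable def prefixTest (p : ℕ)
    (same diff : PublicProtocol (Fin n → Bool) (Fin n → Bool) Bool) :
    PublicProtocol (Fin n → Bool) (Fin n → Bool) Bool :=
  hashTest (fun x => maskWord p (aliceWord x)) (fun y => maskWord p (bobWord y)) same diff 4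

/-- Binary search with backtracking for the first difference of the words. -/
noncomputable def searchProtocol (D : ℕ) :
    ℕ → SearchStack → PublicProtocol (Fin n → Bool) (Fin n → Bool) Bool
  | 0, s => PMF.pure (announceBit (s.minRight D - 1))
  | T + 1, s =>
    prefixTest (s.top D).1
      (prefixTest (((s.top D).1 + (s.top D).2) / 2)
        (searchProtocol D T ((((s.top D).1 + (s.top D).2) / 2, (s.top D).2) :: s))
        (searchProtocol D T (((s.top D).1, ((s.top D).1 + (s.top D).2) / 2) :: s)))
      (searchProtocol D T s.tail)

theorem lengthLE_prefixTest (p : ℕ)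
    {same diff : PublicProtocol (Fin n → Bool) (Fin n → Bool) Bool} {m : ℕ}
    (hs : same.LengthLE m) (hd : diff.LengthLE m) : (prefixTest p same diff).LengthLE (m + 8) :=
  lengthLE_hashTest _ _ hs hd 4

theorem lengthLE_searchProtocol (D T : ℕ) (s : SearchStack) :
    (searchProtocol (n := n) D T s).LengthLE (16 * T + 1) := by
  induction T generalizing s with
  | zero =>
    intro r hr
    rw [searchProtocol, PMF.mem_support_pure_iff] at hr
    rw [hr]
    exact .alice _ fun b => .leaf b
  | succ T ih =>
    -- A round has at most two tests of four hash bits, each bit costing one message from either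
    -- player: 16 bits.
    exact (lengthLE_prefixTest _ (lengthLE_prefixTest _ (ih _) (ih _))
      ((ih _).mono (by omega : _ ≤ 16 * T + 1 + 8))).mono (by omega)

section Analysis

variable {x y : Fin n → Bool} {L : Fin (n + 1)}

theorem failure_prefixTest_of_le (h : ∀ i < L, aliceWord x i = bobWord y i)
    (hL : aliceWord x L ≠ bobWord y L) {p : ℕ} (hp : p ≤ L)
    (same diff : PublicProtocol (Fin n → Bool) (Fin n → Bool) Bool) (v : Bool) :
    ((prefixTest p same diff).failure x y v).toReal = (same.failure x y v).toReal := by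
  rw [prefixTest, failure_hashTest_of_eq (a := fun x => maskWord p (aliceWord x))
    (b := fun y => maskWord p (bobWord y)) ((maskWord_eq_iff h hL p).2 hp)]

theorem failure_prefixTest_of_lt (h : ∀ i < L, aliceWord x i = bobWord y i)
    (hL : aliceWord x L ≠ bobWord y L) {p : ℕ} (hp : L < p)
    (same diff : PublicProtocol (Fin n → Bool) (Fin n → Bool) Bool) (v : Bool) :
    ((prefixTest p same diff).failure x y v).toReal ≤
      (diff.failure x y v).toReal + (same.failure x y v).toReal / 16 := by
  have h1 := failure_hashTest_le (a := fun x => maskWord p (aliceWord x))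
    (b := fun y => maskWord p (bobWord y)) (x := x) (y := y)
    (fun e => hp.not_ge ((maskWord_eq_iff h hL p).1 e)) same diff 4 v
  have ht : ∀ π : PublicProtocol (Fin n → Bool) (Fin n → Bool) Bool, π.failure x y v ≠ ∞ :=
    fun π => ne_top_of_le_ne_top ENNReal.one_ne_top (π.failure_le_one x y v)
  have h2 := ENNReal.toReal_mono (ENNReal.add_ne_top.2
    ⟨ENNReal.mul_ne_top (by simp) (ht diff), ht same⟩) h1
  rw [ENNReal.toReal_add (ENNReal.mul_ne_top (by simp) (ht diff)) (ht same), ENNReal.toReal_mul,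
    ENNReal.toReal_mul, ENNReal.toReal_pow, ENNReal.toReal_ofNat] at h2
  rw [prefixTest]
  linarith

theorem failure_announceBit (h : ∀ i < L, aliceWord x i = bobWord y i)
    (hL : aliceWord x L ≠ bobWord y L) :
    (announceBit (n := n) L).failure x y (greaterThan n x y) = 0 := by
  rw [greaterThan_eq_aliceWord h hL]
  simp [announceBit, PrivateProtocol.failure, PrivateProtocol.run, PMF.pure_bind, PMF.pure_map,
    PMF.toOuterMeasure_pure_apply]
  exact fun _ => L.is_le

/-- Each round shrinks the expected potential to at most 3/4 of its value: the correct move halves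
it, and a wrong one, which needs a hash collision of probability 1/16, at most multiplies it by a
small constant. At the end, a wrong announcement requires potential at least `2 ^ (-D)`. -/
theorem failure_searchProtocol_le (h : ∀ i < L, aliceWord x i = bobWord y i)
    (hL : aliceWord x L ≠ bobWord y L) {D : ℕ} (hD : n < 2 ^ D) (T : ℕ) {s : SearchStack}
    (hs : s.Valid D L) :
    ((searchProtocol (n := n) D T s).failure x y (greaterThan n x y)).toReal ≤
      2 ^ D * (3 / 4) ^ T * s.potential L := by
  have hLD : (L : ℕ) < 2 ^ D := lt_of_le_of_lt (Nat.lt_succ_iff.1 L.2) hD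
  induction T generalizing s with
  | zero =>
    rw [searchProtocol, PublicProtocol.failure, PMF.tsum_pure_mul, pow_zero, mul_one]
    rcases hs.potential_or hLD with h1 | h1
    · refine le_trans ?_ h1
      refine ENNReal.toReal_le_of_le_ofReal zero_le_one ?_
      simpa using PrivateProtocol.failure_le_one x y _ _
    · rw [h1, Nat.add_sub_cancel, failure_announceBit h hL, ENNReal.toReal_zero]
      have := s.potential_pos L
      positivity
  | succ T ih =>
    rw [searchProtocol]
    set lo := (s.top D).1
    set hi := (s.top D).2
    set same := prefixTest ((lo + hi) / 2) (searchProtocol (n := n) D T (((lo + hi) / 2, hi) :: s))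
      (searchProtocol D T ((lo, (lo + hi) / 2) :: s))
    have hP := s.potential_pos L
    set B : ℝ := 2 ^ D * (3 / 4) ^ T
    have hB : 0 < B := by positivity
    have hBP := mul_pos hB hP
    have hB' : 2 ^ D * (3 / 4) ^ (T + 1) * s.potential L = 3 / 4 * (B * s.potential L) := by
      rw [pow_succ]; ring
    rw [hB']
    have hr : ((searchProtocol (n := n) D T (((lo + hi) / 2, hi) :: s)).failure x y
        (greaterThan n x y)).toReal ≤
        B * ((if (lo + hi) / 2 ≤ L then 1 / 2 else 2) * s.potential L) :=
      ih (hs.push_right hLD)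
    by_cases hm : (lo + hi) / 2 ≤ L
    · have e1 : (same.failure x y (greaterThan n x y)).toReal ≤ B * s.potential L / 2 := by
        rw [failure_prefixTest_of_le h hL hm]
        rw [if_pos hm] at hr
        linarith
      by_cases hl : lo ≤ L
      · rw [failure_prefixTest_of_le h hL hl]
        linarith
      · refine (failure_prefixTest_of_lt h hL (not_le.1 hl) _ _ _).trans ?_
        cases s with
        -- On the empty stack the left end is 0, so backtracking is never called for.
        | nil => exact absurd (Nat.zero_le _) hl
        | cons e s =>
          have h2 := ih hs.2.2
          have he : ¬ e.1 ≤ L := hl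
          rw [SearchStack.potential, if_neg he] at e1 hBP ⊢
          rw [List.tail_cons]
          linarith
    · have hl' : ((searchProtocol (n := n) D T ((lo, (lo + hi) / 2) :: s)).failure x y
          (greaterThan n x y)).toReal ≤
          B * ((if lo ≤ L then 1 / 2 else 2) * s.potential L) :=
        ih (hs.push_left hLD (not_le.1 hm))
      have e1 : (same.failure x y (greaterThan n x y)).toReal ≤ _ :=
        failure_prefixTest_of_lt h hL (not_le.1 hm) _ _ _
      rw [if_neg hm] at hr
      by_cases hl : lo ≤ L
      · rw [failure_prefixTest_of_le h hL hl]
        rw [if_pos hl] at hl'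
        linarith
      -- The top interval is wrong: popping halves the potential, and a collision leaves at most 2 +
      -- 2/16 times it, for a total factor 1/2 + (17/8)/16 < 3/4.
      · refine (failure_prefixTest_of_lt h hL (not_le.1 hl) _ _ _).trans ?_
        rw [if_neg hl] at hl'
        cases s with
        | nil => exact absurd (Nat.zero_le _) hl
        | cons e s =>
          have h2 := ih hs.2.2
          have he : ¬ e.1 ≤ L := hl
          rw [SearchStack.potential, if_neg he] at hl' hr hBP ⊢
          rw [List.tail_cons]
          linarith

end Analysis

/-- Three rounds more than halve the bound, as (3/4)³ < 1/2; hence 3D rounds absorb the factor `2 ^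
D`, and 12 more bring the error to 1/16. -/
theorem errorAt_searchProtocol_le {D : ℕ} (hD : n < 2 ^ D) (x y : Fin n → Bool) :
    (searchProtocol (n := n) D (3 * (D + 4)) []).errorAt (greaterThan n) x y ≤ 1 / 10 := by
  obtain ⟨L, h, hL⟩ := exists_first_difference x y
  rw [PublicProtocol.errorAt_eq]
  refine (failure_searchProtocol_le h hL hD _ (s := []) trivial).trans ?_
  rw [SearchStack.potential, mul_one, pow_mul]
  calc (2 : ℝ) ^ D * ((3 / 4) ^ 3) ^ (D + 4) ≤ 2 ^ D * (1 / 2) ^ (D + 4) := by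
        gcongr
        norm_num
    _ = 1 / 16 := by
        rw [pow_add, ← mul_assoc, ← mul_pow]
        norm_num
    _ ≤ 1 / 10 := by norm_num

end Search

/-! ### Assembly of the two bounds -/

theorem mainTheorem6 :
    (∃ c : ℝ, 0 < c ∧ ∃ n₀ : ℕ, ∀ (n : ℕ) [NeZero n], n₀ ≤ n →
      c * Real.logb 2 n ≤ informationComplexity (greaterThan n) (gtDist n) (1 / 10)) ∧
    (∃ C : ℝ, 0 < C ∧ ∀ (n : ℕ) [NeZero n], 2 ≤ n →
      (∃ π : PublicProtocol (Fin n → Bool) (Fin n → Bool) Bool,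
        (∀ x y, π.errorAt (greaterThan n) x y ≤ 1 / 10) ∧
        π.commCost ≤ (⌊C * Real.logb 2 n⌋₊ : ℕ∞)) ∧
      informationComplexity (greaterThan n) (gtDist n) (1 / 10) ≤ C * Real.logb 2 n) := by
  constructor
  · refine ⟨1 / 10, by norm_num, 2 ^ 60, fun n _ hn => ?_⟩
    refine le_csInf ?_ ?_
    -- The real infimum of an empty set would be 0, so some admissible protocol must be exhibited,
    -- here a search with the generous D = n.
    · exact ⟨_, _, PublicProtocol.errorProb_le
        (errorAt_searchProtocol_le (Nat.lt_two_pow_self (n := n))) _, rfl⟩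
    · rintro c ⟨π, hπ, rfl⟩
      exact logb_le_infoCost_gtDist hn π hπ
  · refine ⟨1000, by norm_num, fun n _ hn => ?_⟩
    have hn0 : (0 : ℝ) < n := Nat.cast_pos.2 (by omega)
    have hL : 1 ≤ Real.logb 2 n := by
      rw [Real.le_logb_iff_rpow_le one_lt_two hn0, Real.rpow_one]
      exact_mod_cast hn
    set D := Nat.log 2 n + 1
    have hD : n < 2 ^ D := Nat.lt_pow_succ_log_self one_lt_two n
    have hDL : (D : ℝ) ≤ Real.logb 2 n + 1 := by
      have : (2 : ℝ) ^ Nat.log 2 n ≤ n := by exact_mod_cast Nat.pow_log_le_self 2 (by omega)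
      rw [Nat.cast_add, Nat.cast_one, add_le_add_iff_right,
        Real.le_logb_iff_rpow_le one_lt_two hn0, Real.rpow_natCast]
      exact this
    have herr := errorAt_searchProtocol_le hD
    have hcost := PublicProtocol.commCost_le
      (lengthLE_searchProtocol (n := n) D (3 * (D + 4)) [])
    -- The length is 48D + 193, with D ≤ log₂ n + 1 and log₂ n ≥ 1. Information at most twice
    -- (length + 1) then stays below 1000 log₂ n.
    have hm : ((16 * (3 * (D + 4)) + 1 : ℕ) : ℝ) ≤ 289 * Real.logb 2 n := by
      push_cast
      linarith
    have hmem : (searchProtocol (n := n) D (3 * (D + 4)) []).infoCost (gtDist n) ∈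
        {c : ℝ | ∃ π : PublicProtocol (Fin n → Bool) (Fin n → Bool) Bool,
          π.errorProb (greaterThan n) (gtDist n) ≤ 1 / 10 ∧ π.infoCost (gtDist n) = c} :=
      ⟨_, PublicProtocol.errorProb_le herr _, rfl⟩
    refine ⟨⟨_, herr, hcost.trans ?_⟩, ?_⟩
    · exact_mod_cast Nat.le_floor (hm.trans (by linarith))
    · refine (csInf_le ⟨-(2 / Real.log 2), ?_⟩ hmem).trans
        ((PublicProtocol.infoCost_le_of_commCost_le hcost _).trans ?_)
      · rintro c ⟨π, -, rfl⟩
        exact π.neg_le_infoCost _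
      · linarith
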